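/- **Theorem 1.6 (1).** Let $(M,g)$ be a connected, complete, non-compact smooth Riemannian manifold (without boundary) of dimension $n$, with Riemannian volume $v_g$; write $|A|=v_g(A)$. For $p>1$ and compact $F\subset M$ put $$\mathrm{Cap}_p(F)=\inf\Big\{\int_M|\nabla u|^p\,dv_g:\ u\in C_0^\infty(M),\ u=1\text{ on }F\Big\},$$ $$\lambda_{1,p}(M)=\inf\Big\{\frac{\int_M|\nabla u|^p\,dv_g}{\int_M|u|^p\,dv_g}:\ u\in C_0^\infty(M),\ u\neq0\Big\},\qquad m_p(M)=\inf\Big\{\frac{\mathrm{Cap}_p(F)}{|F|}:\ F\subset M\text{ compact},\ |F|>0\Big\},$$ where $C_0^\infty(M)$ is the space of smooth real functions with compact support. For a compact set $\Omega\subset M$ let $$\mathcal C(\Omega)=\limsup_{p\to\infty}\,p\,\mathrm{Cap}_p(\Omega)^{1/p},$$ and let $$\mathcal V(M)=\limsup_{R\to\infty}\frac{\ln|B(o,R)|}{R}$$ be the volume entropy, where $o\in M$ is any base point. All these quantities take values in the extended real line. Then the limits $$\Lambda(M)=\lim_{p\to\infty}p\,\lambda_{1,p}(M)^{1/p},\qquad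 \mathcal M(M)=\lim_{p\to\infty}p\,m_p(M)^{1/p}$$ exist in $[0,\infty]$, and for every base point $o$ and every compact smooth domain $\Omega$ in $M$ (a nonempty compact set which near each of its boundary points $x$ is a sublevel set $\{f\le0\}$ of a smooth function $f$ with $f(x)=0$, $df_x\neq0$), $$\mathcal V(M)\ \ge\ \mathcal C(\Omega)\ \ge\ \Lambda(M)=\mathcal M(M)\ \ge\ 0 .$$ -/

import Mathlib

open Set Filter Topology MeasureTheory Bundle
open scoped Manifold ContDiff ENNReal

namespace RiemannianAsymptotics

noncomputable section

/-- A compact smooth domain: a nonempty compact set which, near each of its boundary points, is a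
sublevel set `{f ≤ 0}` of a smooth function `f` with `f = 0` and `df ≠ 0` at the point.
(Connectedness is not required.) -/
structure IsCompactSmoothDomain (n : ℕ) {M : Type*} [MetricSpace M]
    [ChartedSpace (EuclideanSpace ℝ (Fin n)) M] (Ω : Set M) : Prop where
  isCompact : IsCompact Ω
  nonempty : Ω.Nonempty
  smooth_boundary : ∀ x ∈ frontier Ω, ∃ f : M → ℝ, ContMDiff (𝓡 n) 𝓘(ℝ, ℝ) ∞ f ∧ f x = 0 ∧
    mfderiv (𝓡 n) 𝓘(ℝ, ℝ) f x ≠ 0 ∧ ∀ᶠ y in 𝓝 x, (y ∈ Ω ↔ f y ≤ 0)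

/-- The Riemannian volume of an `n`-dimensional Riemannian manifold: the `n`-dimensional Hausdorff
measure of the Riemannian distance, normalised so as to be Lebesgue measure on Euclidean space. -/
def vol (n : ℕ) (M : Type*) [MetricSpace M] [MeasurableSpace M] [BorelSpace M] : Measure M :=
  Measure.euclideanHausdorffMeasure n

/-- The class `C^∞_0(M)` of smooth real functions with compact support. -/
def IsTestFunction (n : ℕ) {M : Type*} [MetricSpace M]
    [ChartedSpace (EuclideanSpace ℝ (Fin n)) M] (u : M → ℝ) : Prop :=
  ContMDiff (𝓡 n) 𝓘(ℝ, ℝ) ∞ u ∧ HasCompactSupport u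

/-- The differential `du_x`, a covector at `x`. -/
def differential (n : ℕ) {M : Type*} [MetricSpace M] [ChartedSpace (EuclideanSpace ℝ (Fin n)) M]
    (u : M → ℝ) (x : M) : TangentSpace (𝓡 n) x →L[ℝ] ℝ :=
  mfderiv (𝓡 n) 𝓘(ℝ, ℝ) u x

/-- `|∇u|(x)`, as the norm of the differential `du_x` dual to the Riemannian norm on `T_x M`. -/
def gradNorm (n : ℕ) {M : Type*} [MetricSpace M] [ChartedSpace (EuclideanSpace ℝ (Fin n)) M]
    [RiemannianBundle (fun x : M => TangentSpace (𝓡 n) x)] (u : M → ℝ) (x : M) : ℝ≥0∞ :=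
  ‖differential n u x‖ₑ

/-- The `p`-Dirichlet energy `∫_M |∇u|^p dv_g`. -/
def energy (n : ℕ) {M : Type*} [MetricSpace M] [ChartedSpace (EuclideanSpace ℝ (Fin n)) M]
    [RiemannianBundle (fun x : M => TangentSpace (𝓡 n) x)] [MeasurableSpace M] [BorelSpace M]
    (p : ℝ) (u : M → ℝ) : ℝ≥0∞ :=
  ∫⁻ x, gradNorm n u x ^ p ∂(vol n M)

/-- The `p`-capacity: the infimum of `∫_M |∇u|^p dv_g` over `u ∈ C^∞_0(M)` with `u = 1` on `Ω`. -/
def capacity (n : ℕ) {M : Type*} [MetricSpace M] [ChartedSpace (EuclideanSpace ℝ (Fin n)) M]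
    [RiemannianBundle (fun x : M => TangentSpace (𝓡 n) x)] [MeasurableSpace M] [BorelSpace M]
    (p : ℝ) (Ω : Set M) : ℝ≥0∞ :=
  ⨅ (u : M → ℝ) (_ : IsTestFunction n u ∧ ∀ x ∈ Ω, u x = 1), energy n p u

/-- The first `p`-eigenvalue `λ_{1,p}(M)`: the infimum of the Rayleigh quotients
`∫_M |∇u|^p / ∫_M |u|^p` over the nonzero `u ∈ C^∞_0(M)`. -/
def firstEigenvalue (n : ℕ) (M : Type*) [MetricSpace M]
    [ChartedSpace (EuclideanSpace ℝ (Fin n)) M]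
    [RiemannianBundle (fun x : M => TangentSpace (𝓡 n) x)] [MeasurableSpace M] [BorelSpace M]
    (p : ℝ) : ℝ≥0∞ :=
  ⨅ (u : M → ℝ) (_ : IsTestFunction n u ∧ u ≠ 0),
    energy n p u / ∫⁻ x, ‖u x‖ₑ ^ p ∂(vol n M)

/-- The Maz'ya constant `m_p(M)`: the infimum of `Cap_p(F) / |F|` over the compact sets `F` of
positive volume (those for which the quotient makes sense). -/
def mazyaConstant (n : ℕ) (M : Type*) [MetricSpace M]
    [ChartedSpace (EuclideanSpace ℝ (Fin n)) M]
    [RiemannianBundle (fun x : M => TangentSpace (𝓡 n) x)] [MeasurableSpace M] [BorelSpace M]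
    (p : ℝ) : ℝ≥0∞ :=
  ⨅ (F : Set M) (_ : IsCompact F ∧ vol n M F ≠ 0), capacity n p F / vol n M F

/-- The infinity capacity `C(Ω) = limsup_{p → ∞} p · Cap_p(Ω)^{1/p}`. -/
def infinityCapacity (n : ℕ) {M : Type*} [MetricSpace M]
    [ChartedSpace (EuclideanSpace ℝ (Fin n)) M]
    [RiemannianBundle (fun x : M => TangentSpace (𝓡 n) x)] [MeasurableSpace M] [BorelSpace M]
    (Ω : Set M) : ℝ≥0∞ :=
  limsup (fun p : ℝ => ENNReal.ofReal p * capacity n p Ω ^ (1 / p)) atTop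

/-- `p · λ_{1,p}(M)^{1/p}`. -/
def scaledEigenvalue (n : ℕ) (M : Type*) [MetricSpace M]
    [ChartedSpace (EuclideanSpace ℝ (Fin n)) M]
    [RiemannianBundle (fun x : M => TangentSpace (𝓡 n) x)] [MeasurableSpace M] [BorelSpace M]
    (p : ℝ) : ℝ≥0∞ :=
  ENNReal.ofReal p * firstEigenvalue n M p ^ (1 / p)

/-- `p · m_p(M)^{1/p}`. -/
def scaledMazyaConstant (n : ℕ) (M : Type*) [MetricSpace M]
    [ChartedSpace (EuclideanSpace ℝ (Fin n)) M]
    [RiemannianBundle (fun x : M => TangentSpace (𝓡 n) x)] [MeasurableSpace M] [BorelSpace M]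
    (p : ℝ) : ℝ≥0∞ :=
  ENNReal.ofReal p * mazyaConstant n M p ^ (1 / p)

/-- The infinity eigenvalue `Λ(M) = lim_{p → ∞} p · λ_{1,p}(M)^{1/p}` (meaningful when the limit
exists). -/
def infinityEigenvalue (n : ℕ) (M : Type*) [MetricSpace M]
    [ChartedSpace (EuclideanSpace ℝ (Fin n)) M]
    [RiemannianBundle (fun x : M => TangentSpace (𝓡 n) x)] [MeasurableSpace M] [BorelSpace M] :
    ℝ≥0∞ :=
  limUnder atTop (scaledEigenvalue n M)

/-- The Maz'ya limit `lim_{p → ∞} p · m_p(M)^{1/p}` (meaningful when the limit exists). -/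
def mazyaLimit (n : ℕ) (M : Type*) [MetricSpace M]
    [ChartedSpace (EuclideanSpace ℝ (Fin n)) M]
    [RiemannianBundle (fun x : M => TangentSpace (𝓡 n) x)] [MeasurableSpace M] [BorelSpace M] :
    ℝ≥0∞ :=
  limUnder atTop (scaledMazyaConstant n M)

/-- The volume entropy `limsup_{R → ∞} ln |B(o,R)| / R`, computed from the base point `o`. -/
def volumeEntropy (n : ℕ) {M : Type*} [MetricSpace M] [MeasurableSpace M] [BorelSpace M]
    (o : M) : EReal :=
  limsup (fun R : ℝ => ENNReal.log (vol n M (Metric.ball o R)) / (R : EReal)) atTop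

end

end RiemannianAsymptotics

/-!
Write `λ_p`, `m_p` for the first eigenvalue and the Maz'ya constant.

**Existence of the limits.** For `p < q` and a test function `u`, Hölder's inequality applied to
the gradient of `|u|^(q/p)` gives `p λ_p^(1/p) ≤ q λ_q^(1/q)` (`scaledEigenvalue_mono`). As this
power need not be smooth, regularised powers and Fatou's lemma are used. So `p λ_p^(1/p)`
converges in `[0, ∞]`. Testing the capacity shows `λ_p ≤ m_p`. In the other direction, truncating
`|u|` at the level `t` by a smooth step of slope `C / t` estimates the capacity of `{|u| ≥ t}` by
the energy of `u` in `{δ t ≤ |u| ≤ t}`, and integration over `t` yields `m_p ≤ (p C^p / δ) λ_p`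
(`mazyaConstant_mul_lintegral_le`). After taking `p`-th roots only the factor `C` survives as
`p → ∞`, and `C > 1` is arbitrary: `p m_p^(1/p)` has the same limit (`tendsto_scaledMazyaConstant`).

**Lower bound for `C(Ω)`.** A compact smooth domain has nonempty interior, hence positive finite
volume, so that `m_p |Ω| ≤ Cap_p(Ω)` and `|Ω|^(1/p) → 1` (`le_infinityCapacity_of_tendsto`).

**Upper bound for `C(Ω)`.** Let `V` be larger than the volume entropy. A smooth version of the
radial function decaying like `exp (-(V + ε) r / p)` has gradient about `(V + ε) / p` times
itself, so its `p`-energy is at most `((V + ε) / p)^p` times a constant independent of `p`, which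
gives `C(Ω) ≤ V` as `ε → 0`. It is realised as a weighted sum of smooth cutoffs on consecutive
annuli (`capacity_le_of_exp_growth`).

**Geometry.** Around each point there are charts distorting the metric by a factor arbitrarily
close to `1` (`exists_isNearIsometricChart`). They give continuity of `|∇u|`, local finiteness and
positivity of the volume (a Hausdorff measure), and the approximation of compactly supported
`1`-Lipschitz functions by smooth ones with gradient almost bounded by `1`
(`exists_isTestFunction_approx`), from which the cutoffs are built. Compactness of closed balls is
the Hopf–Rinow theorem (`properSpace_of_forall_exists_dist_le`), proved from the length-space
property.
-/

open scoped NNReal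

set_option linter.unusedSectionVars false

namespace RiemannianAsymptotics

/-! ### Near-isometric charts -/

section
variable {n : ℕ} {M : Type*} [MetricSpace M]
    [ChartedSpace (EuclideanSpace ℝ (Fin n)) M] [IsManifold (𝓡 n) ∞ M]
    [RiemannianBundle (fun x : M => TangentSpace (𝓡 n) x)]
    [IsContMDiffRiemannianBundle (𝓡 n) ∞ (EuclideanSpace ℝ (Fin n))
      (fun x : M => TangentSpace (𝓡 n) x)]

variable (n M) in
theorem isContinuousRiemannianBundle_tangentSpace :
    IsContinuousRiemannianBundle (EuclideanSpace ℝ (Fin n))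
      (fun x : M => TangentSpace (𝓡 n) x) := by
  obtain ⟨g, hg, h⟩ := ‹IsContMDiffRiemannianBundle (𝓡 n) ∞ (EuclideanSpace ℝ (Fin n))
      (fun x : M => TangentSpace (𝓡 n) x)›.exists_contMDiff
  exact ⟨g, hg.continuous, h⟩

/-- A smooth chart with convex image whose differential, and that of its inverse, distort the
Riemannian and Euclidean norms by a factor of at most `r`. Quantitative comparisons of a
Riemannian manifold with Euclidean space go through such charts with `r` close to `1`. The model
norm in `enorm_mfderiv_le` is given explicitly because the tangent spaces of
`EuclideanSpace ℝ (Fin n)` as a manifold carry no norm instance of their own. -/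
structure IsNearIsometricChart (r : ℝ≥0) (e : OpenPartialHomeomorph M (EuclideanSpace ℝ (Fin n))) :
    Prop where
  convex_target : Convex ℝ e.target
  contMDiffOn : ContMDiffOn (𝓡 n) (𝓡 n) ∞ e e.source
  contMDiffOn_symm : ContMDiffOn (𝓡 n) (𝓡 n) ∞ e.symm e.target
  enorm_mfderiv_le : ∀ y ∈ e.source, ∀ v : TangentSpace (𝓡 n) y,
    enorm (E := EuclideanSpace ℝ (Fin n)) (mfderiv (𝓡 n) (𝓡 n) e y v) ≤ r * ‖v‖ₑ
  enorm_mfderiv_symm_le : ∀ z ∈ e.target, ∀ v : EuclideanSpace ℝ (Fin n),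
    ‖mfderiv (𝓡 n) (𝓡 n) e.symm z v‖ₑ ≤ r * ‖v‖ₑ

theorem exists_linearIsometryEquiv_tangentSpace (x : M) :
    Nonempty (TangentSpace (𝓡 n) x ≃ₗᵢ[ℝ] EuclideanSpace ℝ (Fin n)) := by
  have h : Module.finrank ℝ (TangentSpace (𝓡 n) x) = n :=
    finrank_euclideanSpace_fin (𝕜 := ℝ) (n := n)
  have : FiniteDimensional ℝ (TangentSpace (𝓡 n) x) :=
    inferInstanceAs (FiniteDimensional ℝ (EuclideanSpace ℝ (Fin n)))
  exact ⟨((stdOrthonormalBasis ℝ (TangentSpace (𝓡 n) x)).reindex (finCongr h)).repr⟩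

/-- Near-isometric charts exist around every point: compose the preferred chart with a linear map
turning the metric at `x₀` into the Euclidean one, and restrict to the preimage of a small ball;
continuity of the metric bounds the distortion there. -/
theorem exists_isNearIsometricChart (x₀ : M) {r : ℝ≥0} (hr : 1 < r) {W : Set M} (hW : W ∈ 𝓝 x₀) :
    ∃ e : OpenPartialHomeomorph M (EuclideanSpace ℝ (Fin n)), x₀ ∈ e.source ∧ e.source ⊆ W ∧
      IsNearIsometricChart r e := by
  have := isContinuousRiemannianBundle_tangentSpace n M
  obtain ⟨L⟩ := exists_linearIsometryEquiv_tangentSpace (n := n) x₀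
  let T := trivializationAt (EuclideanSpace ℝ (Fin n)) (TangentSpace (𝓡 n) : M → Type _) x₀
  have hx₀ : x₀ ∈ T.baseSet := FiberBundle.mem_baseSet_trivializationAt' x₀
  let G : TangentSpace (𝓡 n) x₀ ≃L[ℝ] EuclideanSpace ℝ (Fin n) :=
    T.continuousLinearEquivAt ℝ x₀ hx₀
  let A : EuclideanSpace ℝ (Fin n) ≃L[ℝ] EuclideanSpace ℝ (Fin n) :=
    G.symm.trans L.toContinuousLinearEquiv
  let c := chartAt (EuclideanSpace ℝ (Fin n)) x₀
  let e₁ : OpenPartialHomeomorph M (EuclideanSpace ℝ (Fin n)) :=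
    c.trans A.toHomeomorph.toOpenPartialHomeomorph
  have hA : ∀ w, A w = L (T.symmL ℝ x₀ w) := fun w =>
    congrArg L (congrFun (T.symm_continuousLinearEquivAt_eq (R := ℝ) hx₀) w)
  have hAs : ∀ w, A.symm w = T.continuousLinearMapAt ℝ x₀ (L.symm w) := fun w =>
    congrFun (T.coe_continuousLinearEquivAt_eq (R := ℝ) hx₀) (L.symm w)
  have h1 := eventually_norm_symmL_trivializationAt_self_comp_lt (EuclideanSpace ℝ (Fin n))
    (TangentSpace (𝓡 n) : M → Type _) x₀ (r := r) (by exact_mod_cast hr)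
  have h2 := eventually_norm_symmL_trivializationAt_comp_self_lt (EuclideanSpace ℝ (Fin n))
    (TangentSpace (𝓡 n) : M → Type _) x₀ (r := r) (by exact_mod_cast hr)
  have hsrc : e₁.source = c.source := by simp [e₁]
  have hx₁ : x₀ ∈ e₁.source := by rw [hsrc]; exact mem_chart_source _ x₀
  obtain ⟨U, hU, hUo, hxU⟩ := mem_nhds_iff.1 (inter_mem hW (h1.and h2))
  obtain ⟨ρ, hρ, hball⟩ := Metric.isOpen_iff.1 ((e₁.symm.isOpen_inter_preimage hUo))
    (e₁ x₀) ⟨by simpa using e₁.map_source hx₁, by simpa [e₁.left_inv hx₁] using hxU⟩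
  let e := (e₁.symm.restrOpen (Metric.ball (e₁ x₀) ρ) Metric.isOpen_ball).symm
  have ht : e.target = Metric.ball (e₁ x₀) ρ := by
    simp only [e, OpenPartialHomeomorph.symm_target, OpenPartialHomeomorph.restrOpen_source,
      OpenPartialHomeomorph.symm_source]
    exact inter_eq_right.2 fun z hz => (hball hz).1
  have hs : e.source ⊆ c.source ∩ U := by
    intro y hy
    have hy' : y ∈ e₁.source ∧ e₁ y ∈ Metric.ball (e₁ x₀) ρ := by simpa [e] using hy
    refine ⟨hsrc ▸ hy'.1, ?_⟩
    simpa [e₁.left_inv hy'.1] using (hball hy'.2).2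
  have he : ∀ y, e y = A (extChartAt (𝓡 n) x₀ y) := fun y => rfl
  have hes : ∀ z, e.symm z = (extChartAt (𝓡 n) x₀).symm (A.symm z) := fun y => rfl
  have hAt : ∀ z ∈ e.target, A.symm z ∈ (extChartAt (𝓡 n) x₀).target := by
    intro z hz
    have h3 := hs (e.map_target hz)
    have h4 : e (e.symm z) = z := e.right_inv hz
    rw [he] at h4
    rw [← h4, A.symm_apply_apply]
    exact (extChartAt (𝓡 n) x₀).map_source (by simpa using h3.1)
  refine ⟨e, ?_, fun y hy => (hU (hs hy).2).1, ?_, ?_, ?_, ?_, ?_⟩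
  · simpa [e, hρ] using hx₁
  · rw [ht]; exact convex_ball _ _
  · refine (A.contDiff.contMDiff.comp_contMDiffOn
      (contMDiffOn_extChartAt (I := 𝓡 n) (x := x₀) (n := ∞))).mono fun y hy => (hs hy).1
  · exact (contMDiffOn_extChartAt_symm (I := 𝓡 n) (n := ∞) x₀).comp
      A.symm.contDiff.contMDiff.contMDiffOn hAt
  · intro y hy v
    have h3 := (hU (hs hy).2).2.1
    rw [TangentBundle.continuousLinearMapAt_trivializationAt (hs hy).1] at h3
    have h4 : HasMFDerivAt (𝓡 n) (𝓡 n) (extChartAt (𝓡 n) x₀) y _ :=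
      (mdifferentiableAt_extChartAt (I := 𝓡 n) (hs hy).1).hasMFDerivAt
    have h5 := (A.hasMFDerivAt (x := extChartAt (𝓡 n) x₀ y)).comp y h4
    have h6 : mfderiv (𝓡 n) (𝓡 n) e y v =
        L (T.symmL ℝ x₀ (mfderiv (𝓡 n) (𝓡 n) (extChartAt (𝓡 n) x₀) y v)) := by
      rw [show (e : M → _) = A ∘ extChartAt (𝓡 n) x₀ from rfl, h5.mfderiv]
      exact hA _
    rw [h6]
    have h7 := ((T.symmL ℝ x₀).comp (mfderiv (𝓡 n) (𝓡 n) (extChartAt (𝓡 n) x₀) y)).le_opENorm v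
    refine (L.enorm_map _).trans_le (h7.trans ?_)
    gcongr
    rw [← enorm_norm, Real.enorm_of_nonneg (norm_nonneg _)]
    exact ENNReal.ofReal_le_of_le_toReal h3.le
  · intro z hz v
    have hy := e.map_target hz
    have h3 := (hU (hs hy).2).2.2
    have h8 : extChartAt (𝓡 n) x₀ (e.symm z) = A.symm z := by
      rw [hes]; exact (extChartAt (𝓡 n) x₀).right_inv (hAt z hz)
    have h9 := TangentBundle.symmL_trivializationAt (𝕜 := ℝ) (I := 𝓡 n) (hs hy).1
    rw [h8] at h9
    have h4 : HasMFDerivAt (𝓡 n) (𝓡 n) (extChartAt (𝓡 n) x₀).symm (A.symm z) _ :=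
      (by simpa [mdifferentiableWithinAt_univ] using
        mdifferentiableWithinAt_extChartAt_symm (I := 𝓡 n) (hAt z hz) :
        MDifferentiableAt (𝓡 n) (𝓡 n) (extChartAt (𝓡 n) x₀).symm (A.symm z)).hasMFDerivAt
    have h5 := h4.comp z (A.symm.hasMFDerivAt (x := z))
    have h6 : mfderiv (𝓡 n) (𝓡 n) e.symm z v =
        T.symmL ℝ (e.symm z) (T.continuousLinearMapAt ℝ x₀ (L.symm v)) := by
      rw [h9]
      rw [show (e.symm : _ → M) = (extChartAt (𝓡 n) x₀).symm ∘ A.symm from rfl, h5.mfderiv, ← hAs]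
      simp only [mfderivWithin_univ, modelWithCornersSelf_coe, range_id]
      rfl
    rw [h6]
    have h7 := ((T.symmL ℝ (e.symm z)).comp (T.continuousLinearMapAt ℝ x₀)).le_opENorm (L.symm v)
    refine h7.trans ?_
    rw [L.symm.enorm_map]
    gcongr
    rw [← enorm_norm, Real.enorm_of_nonneg (norm_nonneg _)]
    exact ENNReal.ofReal_le_of_le_toReal h3.le
end

/-! ### Length structure and properness -/

section
variable {n : ℕ} {M : Type*} [MetricSpace M]
    [ChartedSpace (EuclideanSpace ℝ (Fin n)) M] [IsManifold (𝓡 n) ∞ M]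
    [RiemannianBundle (fun x : M => TangentSpace (𝓡 n) x)]
    [IsContMDiffRiemannianBundle (𝓡 n) ∞ (EuclideanSpace ℝ (Fin n))
      (fun x : M => TangentSpace (𝓡 n) x)]
    [IsRiemannianManifold (𝓡 n) M]

open Manifold

theorem edist_le_pathELength {γ : ℝ → M} {s t : ℝ} (hγ : ContMDiff 𝓘(ℝ, ℝ) (𝓡 n) 1 γ)
    (hst : s ≤ t) : edist (γ s) (γ t) ≤ pathELength (𝓡 n) γ s t := by
  rw [IsRiemannianManifold.out (I := 𝓡 n)]
  exact riemannianEDist_le_pathELength hγ.contMDiffOn rfl rfl hst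

variable (n) in
theorem exists_contMDiff_path {x y : M} {c : ℝ≥0∞} (h : edist x y < c) :
    ∃ γ : ℝ → M, ContMDiff 𝓘(ℝ, ℝ) (𝓡 n) 1 γ ∧ γ 0 = x ∧ γ 1 = y ∧
      pathELength (𝓡 n) γ 0 1 < c := by
  rw [IsRiemannianManifold.out (I := 𝓡 n)] at h
  have := isContinuousRiemannianBundle_tangentSpace n M
  obtain ⟨γ, h0, h1, hγ, hl, -⟩ := exists_lt_locally_constant_of_riemannianEDist_lt h zero_lt_one
  exact ⟨γ, hγ, h0, h1, hl⟩

/-- The Riemannian distance is a length metric: up to an arbitrarily small error, there are points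
at prescribed distances between `x` and `y`. -/
theorem exists_dist_le_dist_lt (n : ℕ) {M : Type*} [MetricSpace M]
    [ChartedSpace (EuclideanSpace ℝ (Fin n)) M] [IsManifold (𝓡 n) ∞ M]
    [RiemannianBundle (fun x : M => TangentSpace (𝓡 n) x)]
    [IsContMDiffRiemannianBundle (𝓡 n) ∞ (EuclideanSpace ℝ (Fin n))
      (fun x : M => TangentSpace (𝓡 n) x)]
    [IsRiemannianManifold (𝓡 n) M]
    {x y : M} {a b : ℝ} (ha : 0 ≤ a) (hb : 0 < b)
    (h : dist x y < a + b) : ∃ z, dist x z ≤ a ∧ dist z y < b := by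
  rcases le_or_gt (dist x y) a with hxy | hxy
  · exact ⟨y, hxy, by simpa using hb⟩
  have h' : edist x y < ENNReal.ofReal (a + b) := by
    rw [edist_dist]; exact (ENNReal.ofReal_lt_ofReal_iff (by linarith)).2 h
  obtain ⟨γ, hγ, h0, h1, hl⟩ := exists_contMDiff_path n h'
  have hc : ContinuousOn (fun t => dist x (γ t)) (Icc 0 1) :=
    (continuous_const.dist hγ.continuous).continuousOn
  obtain ⟨t, ht, hta⟩ := intermediate_value_Icc zero_le_one hc
    (show a ∈ Icc (dist x (γ 0)) (dist x (γ 1)) by simp [h0, h1, ha, hxy.le])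
  refine ⟨γ t, hta.le, ?_⟩
  have e1 := edist_le_pathELength hγ ht.1
  have e2 := edist_le_pathELength hγ ht.2
  rw [h0, edist_dist, show dist x (γ t) = a from hta] at e1
  rw [h1, edist_dist] at e2
  have e3 : ENNReal.ofReal (a + dist (γ t) y) < ENNReal.ofReal (a + b) := by
    rw [ENNReal.ofReal_add ha dist_nonneg]
    refine (add_le_add e1 e2).trans_lt ?_
    rwa [pathELength_add ht.1 ht.2]
  have := (ENNReal.ofReal_lt_ofReal_iff (by linarith)).1 e3
  linarith

/-- **Hopf–Rinow theorem**, metric part: a complete locally compact length space is proper. At the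
supremum `ρ` of the radii of compact balls around `o`, the closed ball of radius `ρ` is totally
bounded, because smaller balls come arbitrarily close to all of its points; a compact
neighbourhood of it then contains a strictly larger ball. -/
theorem properSpace_of_forall_exists_dist_le {X : Type*} [MetricSpace X] [CompleteSpace X]
    [LocallyCompactSpace X]
    (hX : ∀ (x y : X) (a b : ℝ), 0 ≤ a → 0 < b → dist x y < a + b →
      ∃ z, dist x z ≤ a ∧ dist z y < b) : ProperSpace X := by
  refine ⟨fun o R => ?_⟩
  by_contra hR
  let S : Set ℝ := {R | ¬ IsCompact (Metric.closedBall o R)}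
  have hSmono : ∀ {R R'}, R ∈ S → R ≤ R' → R' ∈ S := fun h hle hc =>
    h (hc.of_isClosed_subset Metric.isClosed_closedBall (Metric.closedBall_subset_closedBall hle))
  have hS0 : ∀ R ∈ S, 0 ≤ R := by
    intro R hR
    by_contra hneg
    exact hR (by simp [Metric.closedBall_eq_empty.2 (not_le.1 hneg)])
  have hbdd : BddBelow S := ⟨0, hS0⟩
  let ρ := sInf S
  have hρ0 : 0 ≤ ρ := le_csInf ⟨R, hR⟩ hS0
  have hlt : ∀ s < ρ, IsCompact (Metric.closedBall o s) := fun s hs =>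
    not_not.1 fun h => (csInf_le hbdd h).not_gt hs
  -- the critical closed ball is compact
  have hρ : IsCompact (Metric.closedBall o ρ) := by
    rw [isCompact_iff_totallyBounded_isComplete]
    refine ⟨?_, Metric.isClosed_closedBall.isComplete⟩
    rcases hρ0.eq_or_lt with h0 | hpos
    · rw [← h0, Metric.closedBall_zero]; exact totallyBounded_singleton _
    rw [Metric.totallyBounded_iff]
    intro ε hε
    let s := max 0 (ρ - ε / 4)
    have hs : s < ρ := max_lt hpos (by linarith)
    obtain ⟨t, ht, hcov⟩ := Metric.totallyBounded_iff.1 (hlt s hs).totallyBounded (ε / 2)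
      (by linarith)
    refine ⟨t, ht, fun y hy => ?_⟩
    have hy' : dist o y < s + ε / 2 := by
      have : ρ - ε / 4 ≤ s := le_max_right _ _
      have := Metric.mem_closedBall'.1 hy
      linarith
    obtain ⟨z, hz, hzy⟩ := hX _ _ _ _ (le_max_left 0 (ρ - ε / 4))
      (by linarith : 0 < ε / 2) hy'
    obtain ⟨w, hw, hwz⟩ := mem_iUnion₂.1 (hcov (Metric.mem_closedBall'.2 hz))
    refine mem_iUnion₂.2 ⟨w, hw, ?_⟩
    have := dist_triangle_left y w z
    have := Metric.mem_ball.1 hwz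
    rw [Metric.mem_ball]; linarith
  -- hence so is a slightly larger one
  obtain ⟨K, hK, hKs⟩ := exists_compact_superset hρ
  obtain ⟨δ, hδ, hδK⟩ := hρ.exists_thickening_subset_open isOpen_interior hKs
  obtain ⟨s, hs, hsρ⟩ := exists_lt_of_csInf_lt (⟨R, hR⟩ : S.Nonempty)
    (show sInf S < ρ + δ by simp [ρ, hδ])
  refine hs (hK.of_isClosed_subset Metric.isClosed_closedBall fun y hy => interior_subset (hδK ?_))
  obtain ⟨z, hz, hzy⟩ := hX _ _ _ _ hρ0 hδ
    ((Metric.mem_closedBall'.1 hy).trans_lt hsρ)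
  exact Metric.mem_thickening_iff.2 ⟨z, Metric.mem_closedBall'.2 hz, by rwa [dist_comm]⟩

theorem properSpace_of_complete (n : ℕ) (M : Type*) [MetricSpace M]
    [ChartedSpace (EuclideanSpace ℝ (Fin n)) M] [IsManifold (𝓡 n) ∞ M]
    [RiemannianBundle (fun x : M => TangentSpace (𝓡 n) x)]
    [IsContMDiffRiemannianBundle (𝓡 n) ∞ (EuclideanSpace ℝ (Fin n))
      (fun x : M => TangentSpace (𝓡 n) x)]
    [IsRiemannianManifold (𝓡 n) M]
    [CompleteSpace M] : ProperSpace M :=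
  have : LocallyCompactSpace M := ChartedSpace.locallyCompactSpace (EuclideanSpace ℝ (Fin n)) M
  properSpace_of_forall_exists_dist_le fun _ _ _ _ => exists_dist_le_dist_lt n

/-- The inverse of a near-isometric chart is Lipschitz: it maps segments, which lie in the convex
image of the chart, to paths of controlled length. -/
theorem IsNearIsometricChart.edist_symm_le {r : ℝ≥0}
    {e : OpenPartialHomeomorph M (EuclideanSpace ℝ (Fin n))} (he : IsNearIsometricChart r e)
    {a b : EuclideanSpace ℝ (Fin n)} (ha : a ∈ e.target) (hb : b ∈ e.target) :
    edist (e.symm a) (e.symm b) ≤ r * edist a b := by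
  rw [IsRiemannianManifold.out (I := 𝓡 n)]
  let η := ContinuousAffineMap.lineMap (R := ℝ) a b
  set γ := e.symm ∘ η
  have hη : Icc 0 1 ⊆ η ⁻¹' e.target := by
    rw [← image_subset_iff, ContinuousAffineMap.coe_lineMap_eq, ← segment_eq_image_lineMap]
    exact he.convex_target.segment_subset ha hb
  have hηs : ContMDiff 𝓘(ℝ, ℝ) (𝓡 n) 1 η := by
    rw [contMDiff_iff_contDiff]; exact ContinuousAffineMap.contDiff _
  have : riemannianEDist (𝓡 n) (e.symm a) (e.symm b) ≤ pathELength (𝓡 n) γ 0 1 := by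
    apply riemannianEDist_le_pathELength _ _ _ zero_le_one
    · exact (he.contMDiffOn_symm.of_le (by simp)).comp hηs.contMDiffOn hη
    · simp [γ, η, ContinuousAffineMap.coe_lineMap_eq]
    · simp [γ, η, ContinuousAffineMap.coe_lineMap_eq]
  apply this.trans
  rw [← lintegral_fderiv_lineMap_eq_edist, pathELength_eq_lintegral_mfderivWithin_Icc,
    ← lintegral_const_mul' _ _ ENNReal.coe_ne_top]
  apply setLIntegral_mono' measurableSet_Icc (fun t ht ↦ ?_)
  have : mfderivWithin 𝓘(ℝ, ℝ) (𝓡 n) γ (Icc 0 1) t =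
      (mfderiv (𝓡 n) (𝓡 n) e.symm (η t)) ∘L (mfderivWithin 𝓘(ℝ, ℝ) (𝓡 n) η (Icc 0 1) t) := by
    apply mfderiv_comp_mfderivWithin
    · exact (he.contMDiffOn_symm.contMDiffAt (e.open_target.mem_nhds (hη ht))).mdifferentiableAt
        (by simp)
    · exact hηs.contMDiffOn.mdifferentiableOn one_ne_zero t ht
    · rw [uniqueMDiffWithinAt_iff_uniqueDiffWithinAt]
      exact uniqueDiffOn_Icc zero_lt_one t ht
  rw [show mfderivWithin 𝓘(ℝ, ℝ) (𝓡 n) γ (Icc 0 1) t 1 = (mfderiv (𝓡 n) (𝓡 n) e.symm (η t))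
    (mfderivWithin 𝓘(ℝ, ℝ) (𝓡 n) η (Icc 0 1) t 1) from congr($this 1)]
  refine (he.enorm_mfderiv_symm_le _ (hη ht) _).trans ?_
  simp only [mfderivWithin_eq_fderivWithin]
  exact le_rfl

/-- A near-isometric chart is Lipschitz near each point of its domain. The neighbourhood is needed
so that nearly shortest paths stay in the domain of the chart. -/
theorem IsNearIsometricChart.exists_edist_le {r : ℝ≥0}
    {e : OpenPartialHomeomorph M (EuclideanSpace ℝ (Fin n))} (he : IsNearIsometricChart r e)
    (hr : r ≠ 0) {x₀ : M} (hx₀ : x₀ ∈ e.source) :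
    ∃ U ∈ 𝓝 x₀, U ⊆ e.source ∧ ∀ y ∈ U, ∀ z ∈ U, edist (e y) (e z) ≤ r * edist y z := by
  obtain ⟨δ, hδ, hball⟩ := Metric.nhds_basis_ball.mem_iff.1 (e.open_source.mem_nhds hx₀)
  refine ⟨Metric.ball x₀ (δ / 3), Metric.ball_mem_nhds _ (by positivity),
    (Metric.ball_subset_ball (by linarith)).trans hball, fun y hy z hz => ?_⟩
  have hyz : edist y z < ENNReal.ofReal (2 * δ / 3) := by
    rw [edist_dist]
    refine (ENNReal.ofReal_lt_ofReal_iff (by positivity)).2 ?_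
    have := dist_triangle_right y z x₀
    rw [Metric.mem_ball] at hy hz
    linarith
  -- otherwise a nearly shortest path from `y` to `z` would have a chart image shorter than
  -- `edist (e y) (e z)`
  by_contra! hlt
  have hlt' : edist y z < edist (e y) (e z) / r := by
    rw [ENNReal.lt_div_iff_mul_lt (by simp [hr]) (by simp), mul_comm]
    exact hlt
  obtain ⟨γ, hγ, h0, h1, hl⟩ := exists_contMDiff_path n (lt_min hyz hlt')
  -- a short path between the two points remains in the domain of the chart
  have hsub : ∀ t ∈ Icc (0 : ℝ) 1, γ t ∈ e.source := by
    intro t ht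
    apply hball
    have h2 : edist y (γ t) < ENNReal.ofReal (2 * δ / 3) := by
      rw [← h0]
      exact (edist_le_pathELength hγ ht.1).trans_lt
        ((pathELength_mono le_rfl ht.2).trans_lt (hl.trans_le (min_le_left _ _)))
    rw [edist_dist, ENNReal.ofReal_lt_ofReal_iff (by positivity)] at h2
    have := dist_triangle_left (γ t) x₀ y
    rw [Metric.mem_ball] at hy ⊢
    linarith
  have hC : ContMDiffOn 𝓘(ℝ, ℝ) (𝓡 n) 1 (e ∘ γ) (Icc 0 1) :=
    (he.contMDiffOn.of_le (by simp)).comp hγ.contMDiffOn hsub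
  have hle : edist (e y) (e z) ≤ r * pathELength (𝓡 n) γ 0 1 := by
    rw [edist_comm, edist_eq_enorm_sub, ← h0, ← h1]
    calc ‖(e ∘ γ) 1 - (e ∘ γ) 0‖ₑ
      _ ≤ ∫⁻ t in Icc 0 1, ‖derivWithin (e ∘ γ) (Icc 0 1) t‖ₑ := by
        apply enorm_sub_le_lintegral_derivWithin_Icc_of_contDiffOn_Icc _ zero_le_one
        rwa [← contMDiffOn_iff_contDiffOn]
      _ = ∫⁻ t in Icc 0 1, enorm (E := EuclideanSpace ℝ (Fin n))
          (mfderivWithin 𝓘(ℝ, ℝ) (𝓡 n) (e ∘ γ) (Icc 0 1) t 1) := by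
        simp_rw [← fderivWithin_derivWithin, mfderivWithin_eq_fderivWithin]
        rfl
      _ ≤ ∫⁻ t in Icc 0 1, r * ‖mfderivWithin 𝓘(ℝ, ℝ) (𝓡 n) γ (Icc 0 1) t 1‖ₑ := by
        apply setLIntegral_mono' measurableSet_Icc (fun t ht ↦ ?_)
        have : mfderivWithin 𝓘(ℝ, ℝ) (𝓡 n) (e ∘ γ) (Icc 0 1) t =
            (mfderiv (𝓡 n) (𝓡 n) e (γ t)) ∘L (mfderivWithin 𝓘(ℝ, ℝ) (𝓡 n) γ (Icc 0 1) t) := by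
          apply mfderiv_comp_mfderivWithin
          · exact (he.contMDiffOn.contMDiffAt
              (e.open_source.mem_nhds (hsub t ht))).mdifferentiableAt (by simp)
          · exact (hγ.mdifferentiable one_ne_zero).mdifferentiableOn _ ht
          · rw [uniqueMDiffWithinAt_iff_uniqueDiffWithinAt]
            exact uniqueDiffOn_Icc zero_lt_one t ht
        rw [show mfderivWithin 𝓘(ℝ, ℝ) (𝓡 n) (e ∘ γ) (Icc 0 1) t 1 = (mfderiv (𝓡 n) (𝓡 n) e (γ t))
          (mfderivWithin 𝓘(ℝ, ℝ) (𝓡 n) γ (Icc 0 1) t 1) from congr($this 1)]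
        exact he.enorm_mfderiv_le _ (hsub t ht) _
      _ = r * pathELength (𝓡 n) γ 0 1 := by
        rw [lintegral_const_mul' _ _ ENNReal.coe_ne_top,
          pathELength_eq_lintegral_mfderivWithin_Icc]
  have h3 := ENNReal.mul_lt_mul_right (by simpa using hr) ENNReal.coe_ne_top
    (hl.trans_le (min_le_right _ _)) (a := (r : ℝ≥0∞))
  rw [ENNReal.mul_div_cancel (by simpa using hr) ENNReal.coe_ne_top] at h3
  exact hle.not_gt h3
end

/-! ### Lengths of gradients and the Riemannian volume -/

section
variable {n : ℕ} {M : Type*} [MetricSpace M]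
    [ChartedSpace (EuclideanSpace ℝ (Fin n)) M] [IsManifold (𝓡 n) ∞ M]
    [RiemannianBundle (fun x : M => TangentSpace (𝓡 n) x)]
    {u v : M → ℝ} {x : M}

theorem gradNorm_lt_top : gradNorm n u x < (⊤ : ℝ≥0∞) := enorm_lt_top

theorem gradNorm_le_iff {C : ℝ≥0∞} : gradNorm n u x ≤ C ↔
    ∀ w : TangentSpace (𝓡 n) x, ‖differential n u x w‖ₑ ≤ C * ‖w‖ₑ := by
  constructor
  · intro h w
    exact ((differential n u x).le_opENorm w).trans (by gcongr; exact h)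
  · intro h
    exact ContinuousLinearMap.opENorm_le_bound _ h

theorem gradNorm_congr (h : u =ᶠ[𝓝 x] v) : gradNorm n u x = gradNorm n v x := by
  unfold gradNorm differential
  rw [h.mfderiv_eq]

theorem gradNorm_eq_zero_of_eventuallyEq_const {c : ℝ} (h : u =ᶠ[𝓝 x] fun _ => c) :
    gradNorm n u x = 0 := by
  rw [gradNorm_congr h, ← nonpos_iff_eq_zero, gradNorm_le_iff]
  intro w
  rw [differential, mfderiv_const]
  exact (enorm_zero (E := ℝ)).le.trans zero_le

/-- Chain rule, as an inequality for the length of the gradient. -/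
theorem gradNorm_comp_le {φ : ℝ → ℝ} (hφ : DifferentiableAt ℝ φ (u x))
    (hu : MDifferentiableAt (𝓡 n) 𝓘(ℝ, ℝ) u x) :
    gradNorm n (φ ∘ u) x ≤ ‖deriv φ (u x)‖ₑ * gradNorm n u x := by
  have h1 := hφ.hasFDerivAt.hasMFDerivAt.comp x hu.hasMFDerivAt
  rw [gradNorm_le_iff]
  intro w
  have h2 : differential n (φ ∘ u) x w = deriv φ (u x) * differential n u x w := by
    unfold differential
    rw [h1.mfderiv]
    exact fderiv_eq_smul_deriv (f := φ) (x := u x) (differential n u x w) |>.trans (mul_comm _ _)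
  rw [h2, enorm_mul, mul_assoc]
  gcongr
  exact gradNorm_le_iff.1 le_rfl w

theorem differential_sum {ι : Type*} {s : Finset ι} {f : ι → M → ℝ}
    (hf : ∀ i ∈ s, MDifferentiableAt (𝓡 n) 𝓘(ℝ, ℝ) (f i) x) (w : TangentSpace (𝓡 n) x) :
    differential n (fun y => ∑ i ∈ s, f i y) x w = ∑ i ∈ s, differential n (f i) x w := by
  suffices MDifferentiableAt (𝓡 n) 𝓘(ℝ, ℝ) (fun y => ∑ i ∈ s, f i y) x ∧
    differential n (fun y => ∑ i ∈ s, f i y) x w = ∑ i ∈ s, differential n (f i) x w from this.2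
  induction s using Finset.cons_induction with
  | empty =>
    simp only [Finset.sum_empty]
    exact ⟨mdifferentiableAt_const, congr($(mfderiv_const) w)⟩
  | cons i s his ih =>
    obtain ⟨hd, hs⟩ := ih fun j hj => hf j (Finset.mem_cons_of_mem hj)
    have h := (hf i (Finset.mem_cons_self i s)).hasMFDerivAt.add hd.hasMFDerivAt
    simp only [Finset.sum_cons]
    rw [← hs]
    exact ⟨h.mdifferentiableAt, congr($(h.mfderiv) w)⟩

theorem gradNorm_sum_le {ι : Type*} {s : Finset ι} {f : ι → M → ℝ}
    (hf : ∀ i ∈ s, MDifferentiableAt (𝓡 n) 𝓘(ℝ, ℝ) (f i) x) :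
    gradNorm n (fun y => ∑ i ∈ s, f i y) x ≤ ∑ i ∈ s, gradNorm n (f i) x := by
  refine gradNorm_le_iff.2 fun w => ?_
  rw [differential_sum hf, Finset.sum_mul]
  exact (enorm_sum_le _ _).trans (Finset.sum_le_sum fun i _ => gradNorm_le_iff.1 le_rfl w)

theorem differential_mul (hu : MDifferentiableAt (𝓡 n) 𝓘(ℝ, ℝ) u x)
    (hv : MDifferentiableAt (𝓡 n) 𝓘(ℝ, ℝ) v x) (w : TangentSpace (𝓡 n) x) :
    differential n (fun y => u y * v y) x w =
      u x * differential n v x w + v x * differential n u x w := by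
  exact congr($((hu.hasMFDerivAt.mul hv.hasMFDerivAt).mfderiv) w)

theorem IsNearIsometricChart.gradNorm_le {r : ℝ≥0}
    {e : OpenPartialHomeomorph M (EuclideanSpace ℝ (Fin n))} (he : IsNearIsometricChart r e)
    {x : M} (hx : x ∈ e.source) {f : EuclideanSpace ℝ (Fin n) → ℝ}
    (hf : DifferentiableAt ℝ f (e x)) (huf : u =ᶠ[𝓝 x] f ∘ e) :
    gradNorm n u x ≤ r * ‖fderiv ℝ f (e x)‖ₑ := by
  rw [gradNorm_congr huf, gradNorm_le_iff]
  intro w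
  have h1 : MDifferentiableAt (𝓡 n) (𝓡 n) e x :=
    (he.contMDiffOn.contMDiffAt (e.open_source.mem_nhds hx)).mdifferentiableAt (by simp)
  have h2 := hf.hasFDerivAt.hasMFDerivAt.comp x h1.hasMFDerivAt
  rw [differential, h2.mfderiv]
  refine ((fderiv ℝ f (e x)).le_opENorm _).trans ?_
  rw [mul_comm (r : ℝ≥0∞), mul_assoc]
  gcongr
  exact he.enorm_mfderiv_le x hx w

/-- Together with `IsNearIsometricChart.gradNorm_le`: in a near-isometric chart the Riemannian and
the Euclidean length of a gradient agree up to the factor `r`. -/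
theorem IsNearIsometricChart.enorm_fderiv_le {r : ℝ≥0}
    {e : OpenPartialHomeomorph M (EuclideanSpace ℝ (Fin n))} (he : IsNearIsometricChart r e)
    {x : M} (hx : x ∈ e.source) (hu : MDifferentiableAt (𝓡 n) 𝓘(ℝ, ℝ) u x) :
    ‖fderiv ℝ (u ∘ e.symm) (e x)‖ₑ ≤ r * gradNorm n u x := by
  obtain ⟨z, hz, rfl⟩ : ∃ z ∈ e.target, e.symm z = x := ⟨e x, e.map_source hx, e.left_inv hx⟩
  rw [e.right_inv hz]
  refine ContinuousLinearMap.opENorm_le_bound _ fun w => ?_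
  have h1 : MDifferentiableAt (𝓡 n) (𝓡 n) e.symm z :=
    (he.contMDiffOn_symm.contMDiffAt (e.open_target.mem_nhds hz)).mdifferentiableAt (by simp)
  have h2 := hu.hasMFDerivAt.comp z h1.hasMFDerivAt
  rw [← mfderiv_eq_fderiv, h2.mfderiv]
  refine ((differential n u (e.symm z)).le_opENorm _).trans ?_
  rw [mul_comm (r : ℝ≥0∞), mul_assoc]
  exact mul_le_mul_right (he.enorm_mfderiv_symm_le _ hz w) _

variable [IsContMDiffRiemannianBundle (𝓡 n) ∞ (EuclideanSpace ℝ (Fin n))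
      (fun x : M => TangentSpace (𝓡 n) x)]

/-- In a near-isometric chart of distortion `r`, the function `gradNorm n u` is within a factor
`r` of the Euclidean length of the gradient, which is continuous; now let `r` tend to `1`. -/
theorem continuous_gradNorm (hu : ContMDiff (𝓡 n) 𝓘(ℝ, ℝ) ∞ u) : Continuous (gradNorm n u) := by
  refine continuous_iff_continuousAt.2 fun x => ?_
  have key : ∀ r : ℝ≥0, 1 < r → ∃ F : M → ℝ≥0∞, ContinuousAt F x ∧
      (∀ᶠ y in 𝓝 x, gradNorm n u y ≤ r * F y) ∧ ∀ᶠ y in 𝓝 x, F y ≤ r * gradNorm n u y := by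
    intro r hr
    obtain ⟨e, hx, -, he⟩ := exists_isNearIsometricChart (n := n) x hr univ_mem
    refine ⟨fun y => ‖fderiv ℝ (u ∘ e.symm) (e y)‖ₑ, ?_, ?_, ?_⟩
    · have h1 : ContDiffOn ℝ ∞ (u ∘ e.symm) e.target :=
        contMDiffOn_iff_contDiffOn.1 (hu.comp_contMDiffOn he.contMDiffOn_symm)
      have h2 : ContinuousAt (fderiv ℝ (u ∘ e.symm)) (e x) :=
        (h1.continuousOn_fderiv_of_isOpen e.open_target (by simp)).continuousAt
          (e.open_target.mem_nhds (e.map_source hx))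
      exact (h2.comp (e.continuousAt hx)).enorm
    · filter_upwards [e.open_source.mem_nhds hx] with y hy
      have h1 : ContDiffOn ℝ ∞ (u ∘ e.symm) e.target :=
        contMDiffOn_iff_contDiffOn.1 (hu.comp_contMDiffOn he.contMDiffOn_symm)
      refine he.gradNorm_le hy ((h1.contDiffAt
        (e.open_target.mem_nhds (e.map_source hy))).differentiableAt (by simp)) ?_
      filter_upwards [e.open_source.mem_nhds hy] with z hz
      simp [e.left_inv hz]
    · filter_upwards [e.open_source.mem_nhds hx] with y hy
      exact he.enorm_fderiv_le hy (hu.mdifferentiable (by simp) y)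
  have hr : ∀ c : ℝ≥0∞, c ≠ ⊤ →
      Tendsto (fun r : ℝ≥0 => (r : ℝ≥0∞) * (r * c)) (𝓝[>] 1) (𝓝 c) := by
    intro c hc
    have h0 : Tendsto (fun r : ℝ≥0 => (r : ℝ≥0∞)) (𝓝[>] 1) (𝓝 1) :=
      (ENNReal.tendsto_coe.2 tendsto_id).mono_left nhdsWithin_le_nhds
    have h1 := ENNReal.Tendsto.mul_const (b := c) h0 (Or.inl one_ne_zero)
    simpa using ENNReal.Tendsto.mul h0 (Or.inl one_ne_zero) h1 (Or.inr (by simp))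
  refine tendsto_order.2 ⟨fun a ha => ?_, fun b hb => ?_⟩
  · obtain ⟨r, h1, h2⟩ := (((hr a ha.ne_top).eventually_lt_const ha).and self_mem_nhdsWithin).exists
    obtain ⟨F, hF, hle, hge⟩ := key r h2
    have h3 : r * a < F x := lt_of_mul_lt_mul_left' (h1.trans_le hle.self_of_nhds)
    filter_upwards [hF.eventually_const_lt h3, hge] with y hy hy'
    exact lt_of_mul_lt_mul_left' (hy.trans_le hy')
  · obtain ⟨r, h1, h2⟩ := (((hr _ gradNorm_lt_top.ne).eventually_lt_const hb).and
      self_mem_nhdsWithin).exists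
    obtain ⟨F, hF, hle, hge⟩ := key r h2
    have h3 : r * F x < b := (mul_le_mul_right hge.self_of_nhds _).trans_lt h1
    have h4 : ContinuousAt (fun y => r * F y) x :=
      ENNReal.Tendsto.const_mul hF (Or.inr ENNReal.coe_ne_top)
    filter_upwards [h4.eventually_lt_const h3, hle] with y hy hy'
    exact hy'.trans_lt hy
end

section
variable {n : ℕ} {M : Type*} [MetricSpace M]
    [ChartedSpace (EuclideanSpace ℝ (Fin n)) M] [IsManifold (𝓡 n) ∞ M]
    [RiemannianBundle (fun x : M => TangentSpace (𝓡 n) x)]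
    [IsContMDiffRiemannianBundle (𝓡 n) ∞ (EuclideanSpace ℝ (Fin n))
      (fun x : M => TangentSpace (𝓡 n) x)]
    [IsRiemannianManifold (𝓡 n) M] [MeasurableSpace M] [BorelSpace M]

/-- Hausdorff measure, and so the Riemannian volume, scales at most by `K ^ n` under `K`-Lipschitz
maps. -/
theorem vol_image_le {X Y : Type*} [MetricSpace X] [MeasurableSpace X] [BorelSpace X]
    [MetricSpace Y] [MeasurableSpace Y] [BorelSpace Y] {K : ℝ≥0} {f : X → Y} {s : Set X}
    (hf : LipschitzOnWith K f s) (n : ℕ) : vol n Y (f '' s) ≤ K ^ n * vol n X s := by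
  have := hf.hausdorffMeasure_image_le (d := n) n.cast_nonneg
  simp only [vol, Measure.euclideanHausdorffMeasure_def, Measure.smul_apply, ENNReal.smul_def,
    smul_eq_mul]
  rw [mul_left_comm]
  gcongr
  simpa using this

variable (n M) in
/-- Compact sets have finite volume: locally `M` is a Lipschitz image of a Euclidean ball. -/
theorem isFiniteMeasureOnCompacts_vol : IsFiniteMeasureOnCompacts (vol n M) := by
  suffices IsLocallyFiniteMeasure (vol n M) from inferInstance
  refine ⟨fun x => ?_⟩
  obtain ⟨e, hx, -, he⟩ := exists_isNearIsometricChart (n := n) x one_lt_two univ_mem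
  obtain ⟨ρ, hρ, hball⟩ := Metric.isOpen_iff.1 e.open_target (e x) (e.map_source hx)
  refine ⟨e.symm '' Metric.ball (e x) ρ, ?_, ?_⟩
  · exact (e.symm.isOpen_image_of_subset_source Metric.isOpen_ball hball).mem_nhds
      ⟨e x, Metric.mem_ball_self hρ, e.left_inv hx⟩
  · refine (vol_image_le (K := 2)
      (fun a ha b hb => he.edist_symm_le (hball ha) (hball hb)) n).trans_lt ?_
    rw [vol, EuclideanSpace.euclideanHausdorffMeasure_eq_volume]
    exact ENNReal.mul_lt_top (by simp) measure_ball_lt_top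

variable (n M) in
/-- Nonempty open sets have positive volume: locally they have nonempty open Lipschitz images in
Euclidean space. -/
theorem isOpenPosMeasure_vol : (vol n M).IsOpenPosMeasure := by
  refine ⟨fun W hW ⟨x, hx⟩ hW0 => ?_⟩
  obtain ⟨e, hx, heW, he⟩ := exists_isNearIsometricChart (n := n) x one_lt_two (hW.mem_nhds hx)
  obtain ⟨U, hU, hUe, hlip⟩ := he.exists_edist_le two_ne_zero hx
  obtain ⟨V, hVU, hV, hxV⟩ := mem_nhds_iff.1 hU
  have h1 : vol n _ (e '' V) ≤ _ :=
    vol_image_le (K := 2) (fun a ha b hb => hlip a (hVU ha) b (hVU hb)) n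
  rw [measure_mono_null ((hVU.trans hUe).trans heW) hW0, mul_zero, vol,
    EuclideanSpace.euclideanHausdorffMeasure_eq_volume, nonpos_iff_eq_zero] at h1
  exact (e.isOpen_image_of_subset_source hV (hVU.trans hUe)).measure_ne_zero volume
    ⟨_, mem_image_of_mem _ hxV⟩ h1
end

/-! ### Smooth approximation of Lipschitz functions -/

open ContinuousLinearMap in
/-- Mollification keeps the Lipschitz constant, and its error at `a` is at most the oscillation of
`f` on the ball of radius `ε` around `a`; in particular the mollification equals `f` wherever `f`
is locally constant at scale `ε`. -/
theorem exists_contDiff_lipschitzWith_approx {F : Type*} [NormedAddCommGroup F] [NormedSpace ℝ F]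
    [FiniteDimensional ℝ F] {C : ℝ≥0} {f : F → ℝ} (hf : LipschitzWith C f) {ε : ℝ} (hε : 0 < ε) :
    ∃ g : F → ℝ, ContDiff ℝ ∞ g ∧ LipschitzWith C g ∧
      ∀ a δ, (∀ x ∈ Metric.ball a ε, dist (f x) (f a) ≤ δ) → dist (g a) (f a) ≤ δ := by
  borelize F
  let μ : Measure F := .addHaar
  let φ : ContDiffBump (0 : F) := ⟨ε / 2, ε, half_pos hε, half_lt_self hε⟩
  have hl : LocallyIntegrable f μ := hf.continuous.locallyIntegrable
  refine ⟨convolution (φ.normed μ) f (lsmul ℝ ℝ) μ, ?_, ?_, fun a δ =>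
    φ.dist_normed_convolution_le hl.aestronglyMeasurable⟩
  · exact φ.hasCompactSupport_normed.contDiff_convolution_left _ φ.contDiff_normed hl
  · refine LipschitzWith.of_dist_le_mul fun a b => ?_
    have hi : ∀ a, Integrable (fun t => φ.normed μ t • f (a - t)) μ := fun a =>
      (φ.continuous_normed.smul (hf.continuous.comp (continuous_const.sub continuous_id))
        ).integrable_of_hasCompactSupport φ.hasCompactSupport_normed.smul_right
    rw [Real.dist_eq, convolution_def, convolution_def]
    simp only [lsmul_apply]
    rw [← integral_sub (hi a) (hi b)]
    calc |∫ t, φ.normed μ t • f (a - t) - φ.normed μ t • f (b - t) ∂μ|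
      _ ≤ ∫ t, φ.normed μ t * (C * dist a b) ∂μ := by
        have hint : Integrable (fun t => φ.normed μ t * (C * dist a b)) μ :=
          (φ.integrable_normed (μ := μ)).mul_const (C * dist a b)
        rw [← Real.norm_eq_abs]
        refine norm_integral_le_of_norm_le hint (Eventually.of_forall fun t => ?_)
        rw [← smul_sub, norm_smul, Real.norm_of_nonneg (φ.nonneg_normed t)]
        refine mul_le_mul_of_nonneg_left ?_ (φ.nonneg_normed t)
        simpa [Real.dist_eq] using hf.dist_le_mul (a - t) (b - t)
      _ = C * dist a b := by rw [integral_mul_const, φ.integral_normed (μ := μ), one_mul]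

/-- A smooth transition from `0` to `1` on `[0, 1]` of slope at most `C`, constant on the margins
`s ≤ δ` and `1 - δ ≤ s`. Such functions exist with `δ > 0` for every `C > 1`, see
`exists_isSmoothStep`. -/
structure IsSmoothStep (C δ : ℝ) (φ : ℝ → ℝ) : Prop where
  contDiff : ContDiff ℝ ∞ φ
  eq_zero : ∀ s ≤ δ, φ s = 0
  eq_one : ∀ s, 1 - δ ≤ s → φ s = 1
  abs_deriv_le : ∀ s, |deriv φ s| ≤ C

theorem exists_isSmoothStep {C : ℝ} (hC : 1 < C) :
    ∃ δ φ, 0 < δ ∧ IsSmoothStep C δ φ := by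
  -- a line of slope `C` through `(1/2, 1/2)` leaves margins of width `2 * δ`; mollifying the
  -- truncated line at scale `δ` leaves margins of width `δ`
  obtain ⟨δ, hδ⟩ : ∃ δ, δ = (1 / 2 - 1 / (2 * C)) / 2 := ⟨_, rfl⟩
  have hCδ : C * (1 / 2 - 2 * δ) = 1 / 2 := by rw [hδ]; field_simp; ring
  have hδ0 : 0 < δ := by nlinarith
  let f : ℝ → ℝ := fun s => max 0 (min 1 (C * s + (1 - C) / 2))
  have hf : LipschitzWith C.toNNReal f := by
    refine LipschitzWith.const_max (LipschitzWith.const_min (LipschitzWith.of_dist_le_mul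
      fun a b => ?_) 1) 0
    rw [Real.coe_toNNReal _ (by linarith), Real.dist_eq, Real.dist_eq,
      ← abs_of_pos (by linarith : 0 < C), ← abs_mul, abs_of_pos (by linarith : 0 < C)]
    exact le_of_eq (by congr 1; ring)
  obtain ⟨g, hg, hgl, hga⟩ := exists_contDiff_lipschitzWith_approx hf hδ0
  have hf0 : ∀ s ≤ 2 * δ, f s = 0 := fun s hs =>
    max_eq_left (min_le_of_right_le (by nlinarith))
  have hf1 : ∀ s, 1 - 2 * δ ≤ s → f s = 1 := fun s hs => by
    simp only [f]
    rw [min_eq_left (by nlinarith), max_eq_right zero_le_one]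
  refine ⟨δ, g, hδ0, hg, fun s hs => ?_, fun s hs => ?_, fun s => ?_⟩
  · have := hga s 0 fun x hx => by
      rw [Metric.mem_ball, Real.dist_eq, abs_lt] at hx
      rw [hf0 x (by linarith), hf0 s (by linarith), dist_self]
    rw [dist_le_zero.1 this, hf0 s (by linarith)]
  · have := hga s 0 fun x hx => by
      rw [Metric.mem_ball, Real.dist_eq, abs_lt] at hx
      rw [hf1 x (by linarith), hf1 s (by linarith), dist_self]
    rw [dist_le_zero.1 this, hf1 s (by linarith)]
  · simpa [Real.coe_toNNReal _ (by linarith : 0 ≤ C)] using norm_deriv_le_of_lipschitz hgl (x₀ := s)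

section
variable {n : ℕ} {M : Type*} [MetricSpace M]
    [ChartedSpace (EuclideanSpace ℝ (Fin n)) M] [IsManifold (𝓡 n) ∞ M]
    [RiemannianBundle (fun x : M => TangentSpace (𝓡 n) x)]
    [IsContMDiffRiemannianBundle (𝓡 n) ∞ (EuclideanSpace ℝ (Fin n))
      (fun x : M => TangentSpace (𝓡 n) x)]
    [IsRiemannianManifold (𝓡 n) M]

theorem gradNorm_le_ofReal_iff {u : M → ℝ} {x : M} {c : ℝ} (hc : 0 ≤ c) :
    gradNorm n u x ≤ ENNReal.ofReal c ↔
      ∀ w : TangentSpace (𝓡 n) x, |differential n u x w| ≤ c * ‖w‖ := by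
  rw [gradNorm_le_iff]
  refine forall_congr' fun w => ?_
  rw [← ofReal_norm w, ← ENNReal.ofReal_mul hc, ← ofReal_norm,
    ENNReal.ofReal_le_ofReal_iff (by positivity), Real.norm_eq_abs]

/-- On the domain of a near-isometric chart a `1`-Lipschitz function can be smoothed, by extending
it from the chart to Euclidean space and mollifying there. -/
theorem IsNearIsometricChart.exists_smooth_approx {r : ℝ≥0}
    {e : OpenPartialHomeomorph M (EuclideanSpace ℝ (Fin n))} (he : IsNearIsometricChart r e)
    {h : M → ℝ} (hh : LipschitzWith 1 h) {δ : ℝ} (hδ : 0 < δ) :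
    ∃ g : M → ℝ, ContMDiffOn (𝓡 n) 𝓘(ℝ, ℝ) ∞ g e.source ∧
      ∀ y ∈ e.source, |g y - h y| ≤ δ ∧ gradNorm n g y ≤ ENNReal.ofReal (r * r) := by
  have h1 : LipschitzOnWith r (h ∘ e.symm) e.target := by
    simpa using (hh.lipschitzOnWith (s := univ)).comp
      (fun a ha b hb => he.edist_symm_le ha hb) (mapsTo_univ _ _)
  obtain ⟨H, hH, hHe⟩ := h1.extend_real
  obtain ⟨G, hG, hGl, hGa⟩ := exists_contDiff_lipschitzWith_approx hH
    (show 0 < δ / (r + 1) by positivity)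
  refine ⟨G ∘ e, hG.contMDiff.comp_contMDiffOn he.contMDiffOn, fun y hy => ⟨?_, ?_⟩⟩
  · have h2 : h y = H (e y) := by
      rw [← hHe (e.map_source hy)]; simp [e.left_inv hy]
    rw [h2, ← Real.dist_eq]
    refine hGa (e y) δ fun x hx => (hH.dist_le_mul _ _).trans ?_
    have h3 : dist x (e y) ≤ δ / (r + 1) := (Metric.mem_ball.1 hx).le
    calc r * dist x (e y) ≤ (r + 1) * (δ / (r + 1)) := by gcongr; linarith
      _ = δ := by field_simp
  · refine (he.gradNorm_le hy (hG.differentiable (by simp) _) EventuallyEq.rfl).trans ?_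
    rw [ENNReal.ofReal_mul r.coe_nonneg, ENNReal.ofReal_coe_nnreal]
    gcongr
    rw [← ofReal_norm, ← ENNReal.ofReal_coe_nnreal]
    exact ENNReal.ofReal_le_ofReal (norm_fderiv_le_of_lipschitz ℝ hGl)

theorem gradNorm_eq_zero_of_notMem_tsupport {u : M → ℝ} {x : M} (hx : x ∉ tsupport u) :
    gradNorm n u x = 0 :=
  gradNorm_eq_zero_of_eventuallyEq_const (notMem_tsupport_iff_eventuallyEq.1 hx)

theorem IsTestFunction.exists_gradNorm_le {u : M → ℝ} (hu : IsTestFunction n u) :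
    ∃ B : ℝ≥0, ∀ x, gradNorm n u x ≤ B := by
  rcases (tsupport u).eq_empty_or_nonempty with h | h
  · exact ⟨0, fun x => (gradNorm_eq_zero_of_notMem_tsupport (by simp [h])).le.trans zero_le⟩
  obtain ⟨y, -, hy⟩ := hu.2.isCompact.exists_isMaxOn h (continuous_gradNorm hu.1).continuousOn
  refine ⟨(gradNorm n u y).toNNReal, fun x => ?_⟩
  rw [ENNReal.coe_toNNReal gradNorm_lt_top.ne]
  by_cases hx : x ∈ tsupport u
  · exact hy hx
  · rw [gradNorm_eq_zero_of_notMem_tsupport hx]; exact zero_le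

/-- A compactly supported `1`-Lipschitz function is a uniform limit of test functions with
gradient almost bounded by `1`. Local smoothings `g i` of `h` in near-isometric charts are glued
by a partition of unity `χ i` of the support of `h`. The derivatives of the `χ i` enter only
through `∑ i, (g i - h) dχ i`, since `h ∑ i, dχ i = 0`, and this is small when the `g i` are close
to `h`. -/
theorem exists_isTestFunction_approx [ProperSpace M] {h : M → ℝ} (hh : LipschitzWith 1 h)
    (hc : HasCompactSupport h) {ε : ℝ} (hε : 0 < ε) :
    ∃ g : M → ℝ, IsTestFunction n g ∧
      ∀ x, |g x - h x| ≤ ε ∧ gradNorm n g x ≤ ENNReal.ofReal (1 + ε) := by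
  -- half of the excess `ε` is spent on the distortion of the charts, half on the cutoffs `χ i`
  obtain ⟨r, hr1, hr⟩ : ∃ r : ℝ≥0, 1 < r ∧ (r * r : ℝ) ≤ 1 + ε / 2 := by
    have h0 : 0 ≤ 1 + ε / 2 := by linarith
    refine ⟨(√(1 + ε / 2)).toNNReal, ?_, ?_⟩
    swap
    · rw [Real.coe_toNNReal _ (Real.sqrt_nonneg _), Real.mul_self_sqrt h0]
    rw [← NNReal.coe_lt_coe, Real.coe_toNNReal _ (Real.sqrt_nonneg _)]
    exact Real.lt_sqrt_of_sq_lt (by norm_num; linarith)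
  choose e hxe heb he using fun x : M =>
    exists_isNearIsometricChart (n := n) x hr1 (Metric.ball_mem_nhds x one_pos)
  obtain ⟨t, ht⟩ := hc.isCompact.elim_finite_subcover (fun x => (e x).source)
    (fun x => (e x).open_source) fun x _ => mem_iUnion.2 ⟨x, hxe x⟩
  obtain ⟨χ, hχ⟩ := SmoothPartitionOfUnity.exists_isSubordinate (𝓡 n)
    (isClosed_tsupport h) (fun i : t => (e i).source) (fun i => (e i).open_source)
    (by simpa [iUnion_subtype] using ht)
  have hχt : ∀ i, IsTestFunction n (χ i) := fun i =>
    ⟨(χ i).contMDiff, (isCompact_closedBall (i : M) 1).of_isClosed_subset (isClosed_tsupport _)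
      (((hχ i).trans (heb i)).trans Metric.ball_subset_closedBall)⟩
  have hsum1 : ∀ x ∈ tsupport h, ∑ i, χ i x = 1 := fun x hx => by
    rw [← χ.sum_eq_one hx, finsum_eq_sum_of_fintype]
  have hsumle : ∀ x, ∑ i, χ i x ≤ 1 := fun x => by
    rw [← finsum_eq_sum_of_fintype]; exact χ.sum_le_one x
  have hsumh : ∀ x, (∑ i, χ i x) * h x = h x := fun x => by
    by_cases hx : x ∈ tsupport h
    · rw [hsum1 x hx, one_mul]
    · rw [image_eq_zero_of_notMem_tsupport hx, mul_zero]
  choose B hB using fun i => (hχt i).exists_gradNorm_le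
  obtain ⟨δ, hδ0, hδε, hδB⟩ : ∃ δ > 0, δ ≤ ε ∧ δ * ∑ i, (B i : ℝ) ≤ ε / 2 := by
    have hS : 0 ≤ ∑ i, (B i : ℝ) := Finset.sum_nonneg fun i _ => (B i).coe_nonneg
    refine ⟨min ε (ε / 2 / (∑ i, (B i : ℝ) + 1)), by positivity, min_le_left _ _, ?_⟩
    calc min ε (ε / 2 / (∑ i, (B i : ℝ) + 1)) * ∑ i, (B i : ℝ)
      _ ≤ ε / 2 / (∑ i, (B i : ℝ) + 1) * (∑ i, (B i : ℝ) + 1) := by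
        gcongr
        · exact min_le_right _ _
        · linarith
      _ = ε / 2 := by field_simp
  choose g hg hgh using fun i : t => (he i).exists_smooth_approx hh hδ0
  have hgs : ∀ i, ContMDiff (𝓡 n) 𝓘(ℝ, ℝ) ∞ fun x => χ i x * g i x := fun i =>
    χ.contMDiff_smul fun x hx => (hg i).contMDiffAt ((e i).open_source.mem_nhds (hχ i hx))
  refine ⟨fun x => ∑ i, χ i x * g i x, ⟨?_, ?_⟩, fun x => ⟨?_, ?_⟩⟩
  · exact contMDiff_finsetSum fun i _ => hgs i
  · refine HasCompactSupport.intro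
      (isCompact_iUnion fun i => (hχt i).2.isCompact) fun x hx => Finset.sum_eq_zero fun i _ => ?_
    rw [image_eq_zero_of_notMem_tsupport fun h => hx (mem_iUnion.2 ⟨i, h⟩), zero_mul]
  · calc |∑ i, χ i x * g i x - h x|
      _ = |∑ i, χ i x * (g i x - h x)| := by
        simp_rw [mul_sub]
        rw [Finset.sum_sub_distrib, ← Finset.sum_mul, hsumh]
      _ ≤ ∑ i, χ i x * δ := by
        refine (Finset.abs_sum_le_sum_abs _ _).trans (Finset.sum_le_sum fun i _ => ?_)
        rw [abs_mul, abs_of_nonneg (χ.nonneg i x)]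
        by_cases hx : x ∈ tsupport (χ i)
        · exact mul_le_mul_of_nonneg_left (hgh i x (hχ i hx)).1 (χ.nonneg i x)
        · rw [image_eq_zero_of_notMem_tsupport hx, zero_mul, zero_mul]
      _ ≤ 1 * ε := by
        rw [← Finset.sum_mul]
        have := hsumle x
        gcongr
      _ = ε := one_mul ε
  · refine (gradNorm_le_ofReal_iff (by linarith)).2 fun w => ?_
    have key : ∀ i, |differential n (fun x => χ i x * g i x) x w - h x * differential n (χ i) x w| ≤
        (χ i x * (r * r) + δ * B i) * ‖w‖ := by
      intro i
      by_cases hx : x ∈ tsupport (χ i)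
      · have hxs := hχ i hx
        rw [differential_mul ((χ i).contMDiff.mdifferentiable (by simp) x)
          (((hg i).contMDiffAt ((e i).open_source.mem_nhds hxs)).mdifferentiableAt (by simp))]
        have h1 := (gradNorm_le_ofReal_iff (by positivity)).1 (hgh i x hxs).2 w
        have h2 := (gradNorm_le_ofReal_iff (B i).coe_nonneg).1
          (by simpa using hB i x) w
        calc |χ i x * differential n (g i) x w + g i x * differential n (χ i) x w
              - h x * differential n (χ i) x w|
          _ = |χ i x * differential n (g i) x w + (g i x - h x) * differential n (χ i) x w| := by
            congr 1; ring
          _ ≤ χ i x * |differential n (g i) x w| + |g i x - h x| * |differential n (χ i) x w| := by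
            refine (abs_add_le _ _).trans_eq ?_
            rw [abs_mul, abs_mul, abs_of_nonneg (χ.nonneg i x)]
          _ ≤ χ i x * (r * r * ‖w‖) + δ * (B i * ‖w‖) := by
            have := χ.nonneg i x
            have := (hgh i x hxs).1
            gcongr
          _ = _ := by ring
      · have hx' : x ∉ tsupport fun x => χ i x * g i x := fun h' =>
          hx (closure_mono (Function.support_mul_subset_left _ _) h')
        have h1 := gradNorm_le_iff.1 (gradNorm_eq_zero_of_notMem_tsupport (n := n) hx').le w
        have h2 := gradNorm_le_iff.1 (gradNorm_eq_zero_of_notMem_tsupport (n := n) hx).le w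
        rw [zero_mul, nonpos_iff_eq_zero, enorm_eq_zero] at h1 h2
        rw [h1, h2, mul_zero, sub_zero, abs_zero]
        have := χ.nonneg i x
        positivity
    -- where `h ≠ 0`, the sum of the `χ i` is locally constant
    have hzero : h x * ∑ i, differential n (χ i) x w = 0 := by
      by_cases hx : h x = 0
      · rw [hx, zero_mul]
      have h1 : (fun y => ∑ i, χ i y) =ᶠ[𝓝 x] fun _ => 1 := by
        filter_upwards [(hh.continuous.isOpen_support).mem_nhds hx] with y hy
        exact hsum1 y (subset_tsupport _ hy)
      have h2 := gradNorm_le_iff.1 (gradNorm_eq_zero_of_eventuallyEq_const (n := n) h1).le w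
      rw [zero_mul, nonpos_iff_eq_zero, enorm_eq_zero,
        differential_sum fun i _ => (χ i).contMDiff.mdifferentiable (by simp) x] at h2
      rw [h2, mul_zero]
    rw [differential_sum fun i _ => (hgs i).mdifferentiable (by simp) x, ← sub_zero (∑ i, _),
      ← hzero, Finset.mul_sum, ← Finset.sum_sub_distrib]
    calc _ ≤ ∑ i, (χ i x * (r * r) + δ * B i) * ‖w‖ :=
          (Finset.abs_sum_le_sum_abs _ _).trans (Finset.sum_le_sum fun i _ => key i)
      _ = ((∑ i, χ i x) * (r * r) + δ * ∑ i, (B i : ℝ)) * ‖w‖ := by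
        rw [← Finset.sum_mul, Finset.sum_add_distrib, Finset.sum_mul, Finset.mul_sum]
      _ ≤ (1 * (1 + ε / 2) + ε / 2) * ‖w‖ := by
        gcongr
        exact hsumle x
      _ = _ := by ring

/-- Smooth replacement for the cutoff `max 0 (min 1 (R + 1 - dist x o))`. The gradient vanishes
off the open annulus, everywhere and not only almost everywhere, because a smooth step is applied
to a uniform smooth approximation of that cutoff. -/
theorem exists_cutoff [ProperSpace M] (o : M) (R : ℝ) {ε : ℝ} (hε : 0 < ε) :
    ∃ θ : M → ℝ, IsTestFunction n θ ∧ (∀ x, dist x o ≤ R → θ x = 1) ∧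
      (∀ x, gradNorm n θ x ≤ ENNReal.ofReal (1 + ε)) ∧
      ∀ x, dist x o ≤ R ∨ R + 1 ≤ dist x o → gradNorm n θ x = 0 := by
  -- a factor `√(1 + ε)` each for the step function and for the approximation
  have hs : 1 < √(1 + ε) := Real.lt_sqrt_of_sq_lt (by norm_num; linarith)
  obtain ⟨δ, φ, hδ, hφ⟩ := exists_isSmoothStep hs
  let h : M → ℝ := fun x => max 0 (min 1 (R + 1 - dist x o))
  have hh : LipschitzWith 1 h := by
    refine ((LipschitzWith.of_dist_le_mul fun a b => ?_).const_min 1).const_max 0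
    rw [Real.dist_eq, NNReal.coe_one, one_mul]
    have := abs_dist_sub_le a b o
    rw [abs_sub_comm] at this
    convert this using 2
    ring
  have hc : HasCompactSupport h := HasCompactSupport.intro (isCompact_closedBall o (R + 1))
    fun x hx => max_eq_left (min_le_of_right_le (by
      rw [Metric.mem_closedBall, not_le] at hx; linarith))
  have hγ : 0 < min (δ / 2) (√(1 + ε) - 1) := lt_min (by linarith) (by linarith)
  obtain ⟨g, hg, hgh⟩ := exists_isTestFunction_approx (n := n) hh hc hγ
  have hgδ : ∀ x, |g x - h x| < δ := fun x =>
    ((hgh x).1.trans (min_le_left _ _)).trans_lt (by linarith)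
  have h1 : ∀ x, dist x o ≤ R → 1 - δ < g x := fun x hx => by
    have : h x = 1 := by
      simp only [h]; rw [min_eq_left (by linarith), max_eq_right zero_le_one]
    have := (abs_lt.1 (hgδ x)).1
    linarith
  have h0 : ∀ x, R + 1 ≤ dist x o → g x < δ := fun x hx => by
    have : h x = 0 := max_eq_left (min_le_of_right_le (by linarith))
    have := (abs_lt.1 (hgδ x)).2
    linarith
  refine ⟨φ ∘ g, ⟨hφ.contDiff.contMDiff.comp hg.1, hg.2.comp_left (hφ.eq_zero 0 hδ.le)⟩,
    fun x hx => hφ.eq_one _ (h1 x hx).le, fun x => ?_, fun x hx => ?_⟩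
  · refine (gradNorm_comp_le (hφ.contDiff.differentiable (by simp) _)
      (hg.1.mdifferentiable (by simp) x)).trans ?_
    have h3 : 0 ≤ √(1 + ε) := by linarith
    rw [← Real.mul_self_sqrt (by linarith : 0 ≤ 1 + ε), ENNReal.ofReal_mul h3]
    gcongr
    · rw [← ofReal_norm]
      exact ENNReal.ofReal_le_ofReal (hφ.abs_deriv_le _)
    · refine (hgh x).2.trans (ENNReal.ofReal_le_ofReal ?_)
      linarith [min_le_right (δ / 2) (√(1 + ε) - 1)]
  · rcases hx with hx | hx
    · refine gradNorm_eq_zero_of_eventuallyEq_const (c := 1) ?_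
      filter_upwards [hg.1.continuous.continuousAt.eventually_const_lt (h1 x hx)] with y hy
      exact hφ.eq_one _ hy.le
    · refine gradNorm_eq_zero_of_eventuallyEq_const (c := 0) ?_
      filter_upwards [hg.1.continuous.continuousAt.eventually_lt_const (h0 x hx)] with y hy
      exact hφ.eq_zero _ hy.le
end

/-! ### Monotonicity of the scaled eigenvalues -/

theorem le_ofReal_mul_rpow_iff {x y : ℝ≥0∞} {q : ℝ} (hq : 0 < q) :
    x ≤ ENNReal.ofReal q * y ^ (1 / q) ↔ (x / ENNReal.ofReal q) ^ q ≤ y := by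
  have hq0 : ENNReal.ofReal q ≠ 0 := by simpa using hq
  rw [mul_comm, ← ENNReal.div_le_iff hq0 ENNReal.ofReal_ne_top, one_div, ENNReal.le_rpow_inv_iff hq]

/-- The regularisation `(t² + ε²)^(α/2) - |ε|^α` of `|t|^α`: smooth for `ε ≠ 0`, vanishing at `t =
0`, and convergent to `|t|^α` as `ε → 0`. -/
noncomputable def smoothRpow (α ε t : ℝ) : ℝ := (t ^ 2 + ε ^ 2) ^ (α / 2) - (ε ^ 2) ^ (α / 2)

theorem contDiff_smoothRpow {α ε : ℝ} (hε : ε ≠ 0) : ContDiff ℝ ∞ (smoothRpow α ε) := by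
  refine (ContDiff.rpow_const_of_ne (by fun_prop) fun t => ?_).sub contDiff_const
  positivity

/-- The restriction `α ≤ 2` makes the derivative of the regularisation no larger than that of
`|t|^α`, uniformly in `ε`. -/
theorem abs_deriv_smoothRpow_le {α ε : ℝ} (hα0 : 0 < α) (hα : α ≤ 2) (hε : ε ≠ 0) (t : ℝ) :
    |deriv (smoothRpow α ε) t| ≤ α * |t| ^ (α - 1) := by
  have hpos : 0 < t ^ 2 + ε ^ 2 := by positivity
  have h : HasDerivAt (smoothRpow α ε)
      ((2 * t) * (α / 2) * (t ^ 2 + ε ^ 2) ^ (α / 2 - 1)) t := by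
    have h1 : HasDerivAt (fun t : ℝ => t ^ 2 + ε ^ 2) (2 * t) t := by
      simpa using (hasDerivAt_pow 2 t).add_const (ε ^ 2)
    exact (h1.rpow_const (Or.inl hpos.ne')).sub_const _
  rw [h.deriv]
  rcases eq_or_ne t 0 with rfl | ht
  · simp only [mul_zero, zero_mul, abs_zero]; positivity
  have h2 : (t ^ 2 + ε ^ 2) ^ (α / 2 - 1) ≤ (t ^ 2) ^ (α / 2 - 1) :=
    Real.rpow_le_rpow_of_nonpos (by positivity) (by nlinarith [sq_nonneg ε]) (by linarith)
  have h3 : (t ^ 2) ^ (α / 2 - 1) = |t| ^ (α - 2) := by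
    rw [← sq_abs, ← Real.rpow_natCast, ← Real.rpow_mul (abs_nonneg t)]
    congr 1; push_cast; ring
  have h4 : |t| * |t| ^ (α - 2) = |t| ^ (α - 1) := by
    rw [mul_comm, ← Real.rpow_add_one (abs_ne_zero.2 ht)]; congr 1; ring
  rw [abs_mul, abs_mul, abs_mul, abs_of_pos (Real.rpow_pos_of_pos hpos _), abs_two,
    abs_of_pos (by positivity : 0 < α / 2)]
  calc 2 * |t| * (α / 2) * (t ^ 2 + ε ^ 2) ^ (α / 2 - 1)
    _ ≤ 2 * |t| * (α / 2) * |t| ^ (α - 2) := by rw [← h3]; gcongr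
    _ = α * (|t| * |t| ^ (α - 2)) := by ring
    _ = _ := by rw [h4]

theorem tendsto_smoothRpow {α : ℝ} (hα : 0 < α) (t : ℝ) :
    Tendsto (fun ε => smoothRpow α ε t) (𝓝 0) (𝓝 (|t| ^ α)) := by
  have h : Continuous fun ε => smoothRpow α ε t := by
    unfold smoothRpow
    exact (Continuous.rpow_const (by fun_prop) fun _ => Or.inr (by positivity)).sub
      (Continuous.rpow_const (by fun_prop) fun _ => Or.inr (by positivity))
  convert h.tendsto 0 using 2
  rw [smoothRpow, ← sq_abs, ← Real.rpow_natCast |t|]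
  simp only [ne_eq, OfNat.ofNat_ne_zero, not_false_eq_true, zero_pow, add_zero]
  rw [← Real.rpow_mul (abs_nonneg t), Real.zero_rpow (by positivity)]
  simp [mul_div_cancel₀]

section
variable {n : ℕ} {M : Type*} [MetricSpace M]
    [ChartedSpace (EuclideanSpace ℝ (Fin n)) M] [IsManifold (𝓡 n) ∞ M]
    [RiemannianBundle (fun x : M => TangentSpace (𝓡 n) x)]
    [IsContMDiffRiemannianBundle (𝓡 n) ∞ (EuclideanSpace ℝ (Fin n))
      (fun x : M => TangentSpace (𝓡 n) x)]
    [IsRiemannianManifold (𝓡 n) M] [MeasurableSpace M] [BorelSpace M]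

theorem IsTestFunction.comp {u : M → ℝ} (hu : IsTestFunction n u) {φ : ℝ → ℝ}
    (hφ : ContDiff ℝ ∞ φ) (h0 : φ 0 = 0) : IsTestFunction n (φ ∘ u) :=
  ⟨hφ.contMDiff.comp hu.1, hu.2.comp_left h0⟩

theorem IsTestFunction.lintegral_rpow_ne_top {u : M → ℝ} (hu : IsTestFunction n u) {p : ℝ}
    (hp : 0 < p) : ∫⁻ x, ‖u x‖ₑ ^ p ∂(vol n M) ≠ ⊤ := by
  have := isFiniteMeasureOnCompacts_vol n M
  obtain ⟨C, hC⟩ := hu.2.exists_bound_of_continuous hu.1.continuous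
  have hle : ∀ x, ‖u x‖ₑ ^ p ≤ (tsupport u).indicator (fun _ => ENNReal.ofReal C ^ p) x := by
    intro x
    by_cases hx : x ∈ tsupport u
    · rw [indicator_of_mem hx, ← ofReal_norm]
      exact ENNReal.rpow_le_rpow (ENNReal.ofReal_le_ofReal (hC x)) hp.le
    · rw [image_eq_zero_of_notMem_tsupport hx, enorm_zero, ENNReal.zero_rpow_of_pos hp]
      exact zero_le
  refine ((lintegral_mono hle).trans_lt ?_).ne
  rw [lintegral_indicator_const (isClosed_tsupport u).measurableSet]
  exact ENNReal.mul_lt_top (ENNReal.rpow_lt_top_of_nonneg hp.le ENNReal.ofReal_ne_top)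
    hu.2.isCompact.measure_lt_top

theorem IsTestFunction.lintegral_rpow_ne_zero {u : M → ℝ} (hu : IsTestFunction n u) (hu0 : u ≠ 0)
    {p : ℝ} (hp : 0 < p) : ∫⁻ x, ‖u x‖ₑ ^ p ∂(vol n M) ≠ 0 := by
  have := isOpenPosMeasure_vol n M
  obtain ⟨x, hx⟩ := Function.ne_iff.1 hu0
  have hm : Measurable fun x => ‖u x‖ₑ ^ p := hu.1.continuous.measurable.enorm.pow_const p
  rw [← pos_iff_ne_zero, lintegral_pos_iff_support hm]
  refine (hu.1.continuous.isOpen_support.measure_pos (vol n M) ⟨x, hx⟩).trans_le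
    (measure_mono fun y hy => ?_)
  simpa [Function.mem_support, ENNReal.rpow_eq_zero_iff, hp, hp.not_gt] using hy

theorem firstEigenvalue_mul_le {u : M → ℝ} (hu : IsTestFunction n u) {p : ℝ} (hp : 0 < p) :
    firstEigenvalue n M p * ∫⁻ x, ‖u x‖ₑ ^ p ∂(vol n M) ≤ energy n p u := by
  by_cases h : u = 0
  · simp [h, ENNReal.zero_rpow_of_pos hp]
  · exact ENNReal.mul_le_of_le_div (iInf₂_le u ⟨hu, h⟩)

theorem measurable_gradNorm {u : M → ℝ} (hu : IsTestFunction n u) : Measurable (gradNorm n u) :=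
  (continuous_gradNorm hu.1).measurable

/-- Hölder's inequality for the gradient `(q / p) |u|^(q/p - 1) |∇u|` of `|u|^(q/p)`. -/
theorem energy_smoothRpow_comp_le {u : M → ℝ} (hu : IsTestFunction n u) {p q ε : ℝ} (hp : 0 < p)
    (hpq : p < q) (hq : q ≤ 2 * p) (hε : ε ≠ 0) :
    energy n p (smoothRpow (q / p) ε ∘ u) ≤ ENNReal.ofReal (q / p) ^ p *
      ((∫⁻ x, ‖u x‖ₑ ^ q ∂(vol n M)) ^ (1 - p / q) * energy n q u ^ (p / q)) := by
  have hq0 : 0 < q := hp.trans hpq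
  have hα : 1 < q / p := (one_lt_div hp).2 hpq
  have hmu : Measurable fun x => ‖u x‖ₑ ^ q := hu.1.continuous.measurable.enorm.pow_const q
  have hmg : Measurable fun x => gradNorm n u x ^ q := (measurable_gradNorm hu).pow_const q
  calc energy n p (smoothRpow (q / p) ε ∘ u)
    _ ≤ ∫⁻ x, ENNReal.ofReal (q / p) ^ p *
        ((‖u x‖ₑ ^ q) ^ (1 - p / q) * (gradNorm n u x ^ q) ^ (p / q)) ∂(vol n M) := by
      refine lintegral_mono fun x => ?_
      have h1 : gradNorm n (smoothRpow (q / p) ε ∘ u) x ≤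
          ENNReal.ofReal (q / p) * ‖u x‖ₑ ^ (q / p - 1) * gradNorm n u x := by
        refine (gradNorm_comp_le ((contDiff_smoothRpow hε).differentiable (by simp) _)
          (hu.1.mdifferentiable (by simp) x)).trans ?_
        gcongr
        rw [← ofReal_norm, ← ofReal_norm, ENNReal.ofReal_rpow_of_nonneg (norm_nonneg _)
          (by linarith), ← ENNReal.ofReal_mul (by positivity)]
        exact ENNReal.ofReal_le_ofReal
          (abs_deriv_smoothRpow_le (by positivity) ((div_le_iff₀ hp).2 hq) hε _)
      refine (ENNReal.rpow_le_rpow h1 hp.le).trans_eq ?_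
      rw [ENNReal.mul_rpow_of_nonneg _ _ hp.le, ENNReal.mul_rpow_of_nonneg _ _ hp.le, mul_assoc,
        ← ENNReal.rpow_mul, ← ENNReal.rpow_mul, ← ENNReal.rpow_mul]
      congr 3
      · field_simp
      · field_simp
    _ = ENNReal.ofReal (q / p) ^ p *
        ∫⁻ x, (‖u x‖ₑ ^ q) ^ (1 - p / q) * (gradNorm n u x ^ q) ^ (p / q) ∂(vol n M) :=
      lintegral_const_mul _ ((hmu.pow_const _).mul (hmg.pow_const _))
    _ ≤ _ := by
      gcongr
      refine ENNReal.lintegral_mul_norm_pow_le hmu.aemeasurable hmg.aemeasurable ?_ (by positivity)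
        (by ring)
      rw [sub_nonneg]
      exact (div_le_one hq0).2 hpq.le

/-- The Rayleigh quotient bound for the power `|u|^(q/p)`, which is not smooth: apply it to the
regularised powers and pass to the limit by Fatou's lemma. -/
theorem firstEigenvalue_mul_lintegral_rpow_le {u : M → ℝ} (hu : IsTestFunction n u) {p q : ℝ}
    (hp : 0 < p) (hpq : p < q) (hq : q ≤ 2 * p) :
    firstEigenvalue n M p * ∫⁻ x, ‖u x‖ₑ ^ q ∂(vol n M) ≤ ENNReal.ofReal (q / p) ^ p *
      ((∫⁻ x, ‖u x‖ₑ ^ q ∂(vol n M)) ^ (1 - p / q) * energy n q u ^ (p / q)) := by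
  have hα : 0 < q / p := div_pos (hp.trans hpq) hp
  let ε : ℕ → ℝ := fun k => 1 / ((k : ℝ) + 1)
  have hε : ∀ k, ε k ≠ 0 := fun k => by positivity
  let f : ℕ → M → ℝ≥0∞ := fun k x => ‖(smoothRpow (q / p) (ε k) ∘ u) x‖ₑ ^ p
  have ht : ∀ k, IsTestFunction n (smoothRpow (q / p) (ε k) ∘ u) := fun k =>
    hu.comp (contDiff_smoothRpow (hε k)) (by simp [smoothRpow])
  have hm : ∀ k, Measurable (f k) := fun k =>
    (ht k).1.continuous.measurable.enorm.pow_const p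
  have hlim : ∀ x, ‖u x‖ₑ ^ q = liminf (fun k => f k x) atTop := by
    intro x
    have h1 : Tendsto (fun k => smoothRpow (q / p) (ε k) (u x)) atTop (𝓝 (|u x| ^ (q / p))) :=
      (tendsto_smoothRpow hα (u x)).comp tendsto_one_div_add_atTop_nhds_zero_nat
    have h2 := (ENNReal.continuous_rpow_const (y := p)).tendsto _ |>.comp h1.enorm
    have h3 : ‖|u x| ^ (q / p)‖ₑ ^ p = ‖u x‖ₑ ^ q := by
      rw [← ofReal_norm, Real.norm_of_nonneg (by positivity), ← Real.norm_eq_abs,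
        ← ENNReal.ofReal_rpow_of_nonneg (norm_nonneg _) hα.le, ofReal_norm, ← ENNReal.rpow_mul,
        div_mul_cancel₀ _ hp.ne']
    rw [← h3]
    exact h2.liminf_eq.symm
  have hF : ∫⁻ x, ‖u x‖ₑ ^ q ∂(vol n M) ≤ ⨆ k, ∫⁻ x, f k x ∂(vol n M) := by
    simp_rw [hlim]
    exact (lintegral_liminf_le hm).trans ((liminf_le_limsup).trans limsup_le_iSup)
  refine (mul_le_mul_right hF _).trans ?_
  rw [ENNReal.mul_iSup]
  exact iSup_le fun k => (firstEigenvalue_mul_le (ht k) hp).trans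
    (energy_smoothRpow_comp_le hu hp hpq hq (hε k))

theorem scaledEigenvalue_le_of_le_two_mul {p q : ℝ} (hp : 0 < p) (hpq : p ≤ q) (hq : q ≤ 2 * p) :
    scaledEigenvalue n M p ≤ scaledEigenvalue n M q := by
  rcases hpq.eq_or_lt with rfl | hpq
  · rfl
  have hq0 : 0 < q := hp.trans hpq
  refine (le_ofReal_mul_rpow_iff hq0).2 (le_iInf₂ fun u hu => (le_ofReal_mul_rpow_iff hq0).1 ?_)
  have h := firstEigenvalue_mul_lintegral_rpow_le hu.1 hp hpq hq
  have hJ0 := hu.1.lintegral_rpow_ne_zero hu.2 hq0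
  have hJt := hu.1.lintegral_rpow_ne_top hq0
  set J := ∫⁻ x, ‖u x‖ₑ ^ q ∂(vol n M)
  have h1 : firstEigenvalue n M p ≤ ENNReal.ofReal (q / p) ^ p * (energy n q u / J) ^ (p / q) := by
    rw [← ENNReal.mul_le_mul_iff_left hJ0 hJt]
    refine h.trans_eq ?_
    rw [ENNReal.div_rpow_of_nonneg _ _ (by positivity), ENNReal.rpow_sub _ _ hJ0 hJt,
      ENNReal.rpow_one]
    simp only [div_eq_mul_inv]
    ring
  calc scaledEigenvalue n M p
    _ ≤ ENNReal.ofReal p *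
        (ENNReal.ofReal (q / p) ^ p * (energy n q u / J) ^ (p / q)) ^ (1 / p) := by
      unfold scaledEigenvalue; gcongr
    _ = ENNReal.ofReal p * ENNReal.ofReal (q / p) * (energy n q u / J) ^ (1 / q) := by
      rw [ENNReal.mul_rpow_of_nonneg _ _ (by positivity), ← ENNReal.rpow_mul, ← ENNReal.rpow_mul,
        mul_one_div_cancel hp.ne', ENNReal.rpow_one, mul_assoc]
      congr 3
      field_simp
    _ = _ := by
      rw [← ENNReal.ofReal_mul hp.le, mul_div_cancel₀ _ hp.ne']

/-- The bound `q ≤ 2 * p` is removed by passing from `p` to `q` in several steps. -/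
theorem scaledEigenvalue_mono {p q : ℝ} (hp : 0 < p) (hpq : p ≤ q) :
    scaledEigenvalue n M p ≤ scaledEigenvalue n M q := by
  have key : ∀ k : ℕ, ∀ q, p ≤ q → q ≤ 2 ^ k * p →
      scaledEigenvalue n M p ≤ scaledEigenvalue n M q := by
    intro k
    induction k with
    | zero => intro q h1 h2; rw [le_antisymm h1 (by simpa using h2)]
    | succ k ih =>
      intro q h1 h2
      rcases le_total q (2 * p) with h | h
      · exact scaledEigenvalue_le_of_le_two_mul hp h1 h
      · rw [pow_succ] at h2
        exact (ih (q / 2) (by linarith) (by linarith)).trans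
          (scaledEigenvalue_le_of_le_two_mul (by linarith) (by linarith) (by linarith))
  obtain ⟨k, hk⟩ := pow_unbounded_of_one_lt (q / p) one_lt_two
  exact key k q hpq ((div_le_iff₀ hp).1 hk.le)

/-- A test function equal to `1` on `F` satisfies `∫ |u|^p ≥ |F|`. -/
theorem firstEigenvalue_le_mazyaConstant {p : ℝ} (hp : 0 < p) :
    firstEigenvalue n M p ≤ mazyaConstant n M p := by
  have := isFiniteMeasureOnCompacts_vol n M
  refine le_iInf₂ fun F hF => ?_
  rw [ENNReal.le_div_iff_mul_le (Or.inl hF.2) (Or.inl hF.1.measure_ne_top)]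
  refine le_iInf₂ fun u hu => le_trans ?_ (firstEigenvalue_mul_le hu.1 hp)
  gcongr
  calc vol n M F = ∫⁻ _ in F, 1 ∂(vol n M) := by simp
    _ = ∫⁻ x in F, ‖u x‖ₑ ^ p ∂(vol n M) :=
      setLIntegral_congr_fun hF.1.measurableSet fun x hx => by simp [hu.2 x hx]
    _ ≤ _ := setLIntegral_le_lintegral _ _

/-! ### Maz'ya's capacitary inequality -/

theorem IsSmoothStep.deriv_eq_zero {C δ : ℝ} {φ : ℝ → ℝ} (hφ : IsSmoothStep C δ φ) {s : ℝ}
    (hs : s < δ ∨ 1 - δ < s) : deriv φ s = 0 := by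
  rcases hs with hs | hs
  · have h : φ =ᶠ[𝓝 s] fun _ => 0 := by
      filter_upwards [eventually_lt_nhds hs] with y hy using hφ.eq_zero y hy.le
    rw [h.deriv_eq, deriv_const]
  · have h : φ =ᶠ[𝓝 s] fun _ => 1 := by
      filter_upwards [eventually_gt_nhds hs] with y hy using hφ.eq_one y hy.le
    rw [h.deriv_eq, deriv_const]

theorem IsSmoothStep.contDiff_comp_abs {C δ : ℝ} {φ : ℝ → ℝ} (hφ : IsSmoothStep C δ φ)
    (hδ : 0 < δ) (t : ℝ) : ContDiff ℝ ∞ fun s => φ (|s| / t) := by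
  rw [contDiff_iff_contDiffAt]
  intro s
  rcases eq_or_ne s 0 with rfl | hs
  · have h : (fun s => φ (|s| / t)) =ᶠ[𝓝 0] fun _ => 0 := by
      have : ContinuousAt (fun s : ℝ => |s| / t) 0 := by fun_prop
      filter_upwards [this.eventually_lt_const (by simpa using hδ)] with y hy
      exact hφ.eq_zero _ hy.le
    exact contDiffAt_const.congr_of_eventuallyEq h
  · exact hφ.contDiff.contDiffAt.comp s ((contDiffAt_abs hs).div_const t)

theorem IsSmoothStep.abs_deriv_comp_abs_le {C δ : ℝ} {φ : ℝ → ℝ} (hφ : IsSmoothStep C δ φ)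
    (hδ : 0 < δ) {t : ℝ} (ht : 0 < t) (s : ℝ) :
    |deriv (fun s => φ (|s| / t)) s| ≤ C / t ∧
      (¬ (δ * t ≤ |s| ∧ |s| ≤ t) → deriv (fun s => φ (|s| / t)) s = 0) := by
  have hC : 0 ≤ C := (abs_nonneg _).trans (hφ.abs_deriv_le 0)
  rcases eq_or_ne s 0 with rfl | hs
  · have h : (fun s => φ (|s| / t)) =ᶠ[𝓝 0] fun _ => 0 := by
      have : ContinuousAt (fun s : ℝ => |s| / t) 0 := by fun_prop
      filter_upwards [this.eventually_lt_const (by simpa using hδ)] with y hy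
      exact hφ.eq_zero _ hy.le
    rw [h.deriv_eq, deriv_const]
    exact ⟨by rw [abs_zero]; positivity, fun _ => rfl⟩
  · have h : HasDerivAt (fun s => φ (|s| / t)) (deriv φ (|s| / t) * (SignType.sign s / t)) s :=
      ((hφ.contDiff.differentiable (by simp) _).hasDerivAt).comp s
        ((hasDerivAt_abs hs).div_const t)
    rw [h.deriv]
    refine ⟨?_, fun hst => ?_⟩
    · have h1 : |((SignType.sign s : SignType) : ℝ)| ≤ 1 := by
        rcases lt_or_gt_of_ne hs with h | h <;> simp [h]
      rw [abs_mul, abs_div, abs_of_pos ht]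
      calc |deriv φ (|s| / t)| * (|((SignType.sign s : SignType) : ℝ)| / t)
        _ ≤ C * (1 / t) := by gcongr; exact hφ.abs_deriv_le _
        _ = C / t := by ring
    · rw [hφ.deriv_eq_zero, zero_mul]
      rw [not_and_or, not_le, not_le] at hst
      rcases hst with h | h
      · left; rwa [div_lt_iff₀ ht]
      · right
        have : 1 < |s| / t := (one_lt_div ht).2 h
        linarith

/-- Maz'ya's truncation: the function `φ (|u| / t)` equals `1` where `|u| ≥ t` and has its
gradient supported where `δ t ≤ |u| ≤ t`, and so bounds the capacity of the superlevel set. -/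
theorem mazyaConstant_mul_vol_le {u : M → ℝ} (hu : IsTestFunction n u) {p C δ : ℝ} (hp : 0 < p)
    {φ : ℝ → ℝ} (hφ : IsSmoothStep C δ φ) (hδ : 0 < δ) {t : ℝ} (ht : 0 < t) :
    mazyaConstant n M p * vol n M {x | t ≤ |u x|} ≤
      ∫⁻ x, {x | δ * t ≤ |u x| ∧ |u x| ≤ t}.indicator
        (fun x => ENNReal.ofReal (C / t) ^ p * gradNorm n u x ^ p) x ∂(vol n M) := by
  have hF : IsCompact {x | t ≤ |u x|} := by
    refine hu.2.isCompact.of_isClosed_subset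
      (isClosed_le continuous_const hu.1.continuous.abs) fun x hx => subset_tsupport _ ?_
    rw [Function.mem_support]
    rintro h
    rw [mem_ofPred_eq, h, abs_zero] at hx
    exact ht.not_ge hx
  by_cases h0 : vol n M {x | t ≤ |u x|} = 0
  · rw [h0, mul_zero]; exact zero_le
  have hv : IsTestFunction n ((fun s => φ (|s| / t)) ∘ u) :=
    hu.comp (hφ.contDiff_comp_abs hδ t) (by simpa using hφ.eq_zero 0 hδ.le)
  have hv1 : ∀ x ∈ {x | t ≤ |u x|}, ((fun s => φ (|s| / t)) ∘ u) x = 1 := fun x hx => by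
    have : 1 ≤ |u x| / t := (one_le_div ht).2 hx
    exact hφ.eq_one _ (by linarith)
  refine (ENNReal.mul_le_of_le_div (iInf₂_le _ ⟨hF, h0⟩)).trans ((iInf₂_le _ ⟨hv, hv1⟩).trans
    (lintegral_mono fun x => ?_))
  · have h1 := gradNorm_comp_le (n := n) ((hφ.contDiff_comp_abs hδ t).differentiable (by simp) _)
      (hu.1.mdifferentiable (by simp) x)
    obtain ⟨h2, h3⟩ := hφ.abs_deriv_comp_abs_le hδ ht (u x)
    by_cases hx : x ∈ {x | δ * t ≤ |u x| ∧ |u x| ≤ t}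
    · rw [indicator_of_mem hx, ← ENNReal.mul_rpow_of_nonneg _ _ hp.le]
      refine ENNReal.rpow_le_rpow (h1.trans ?_) hp.le
      gcongr
      rw [← ofReal_norm]
      exact ENNReal.ofReal_le_ofReal h2
    · rw [h3 hx, enorm_zero, zero_mul, nonpos_iff_eq_zero] at h1
      rw [h1, ENNReal.zero_rpow_of_pos hp]
      exact zero_le

/-- **Maz'ya's capacitary inequality**: integrate the truncation estimate against `p t^(p-1) dt`.
By Tonelli's theorem each point `x` is counted for `t` in `[|u x|, |u x| / δ]` only, with the
density `C^p / t`, which contributes at most `C^p / δ`. -/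
theorem mazyaConstant_mul_lintegral_le [SFinite (vol n M)] {u : M → ℝ} (hu : IsTestFunction n u)
    {p C δ : ℝ} (hp : 0 < p) {φ : ℝ → ℝ} (hφ : IsSmoothStep C δ φ) (hδ : 0 < δ) :
    mazyaConstant n M p * ∫⁻ x, ‖u x‖ₑ ^ p ∂(vol n M) ≤
      ENNReal.ofReal (p * C ^ p / δ) * energy n p u := by
  have hC : 0 ≤ C := (abs_nonneg _).trans (hφ.abs_deriv_le 0)
  have hum : Measurable u := hu.1.continuous.measurable
  let S : ℝ → M → ℝ≥0∞ := fun t => {x | δ * t ≤ |u x| ∧ |u x| ≤ t}.indicator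
    (fun x => ENNReal.ofReal (C ^ p * t⁻¹) * gradNorm n u x ^ p)
  have hS : Measurable (Function.uncurry S) := by
    have h1 : MeasurableSet {z : ℝ × M | δ * z.1 ≤ |u z.2| ∧ |u z.2| ≤ z.1} :=
      (measurableSet_le (measurable_fst.const_mul δ) (hum.comp measurable_snd).norm).inter
        (measurableSet_le (hum.comp measurable_snd).norm measurable_fst)
    exact Measurable.indicator (f := fun z : ℝ × M =>
      ENNReal.ofReal (C ^ p * z.1⁻¹) * gradNorm n u z.2 ^ p)
      ((measurable_fst.inv.const_mul _).ennreal_ofReal.mul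
        (((measurable_gradNorm hu).comp measurable_snd).pow_const p)) h1
  have hlayer : ∫⁻ x, ‖u x‖ₑ ^ p ∂(vol n M) = ENNReal.ofReal p *
      ∫⁻ t in Ioi 0, vol n M {x | t ≤ |u x|} * ENNReal.ofReal (t ^ (p - 1)) := by
    rw [← lintegral_rpow_eq_lintegral_meas_le_mul (vol n M)
      (Eventually.of_forall fun x => abs_nonneg (u x)) hum.norm.aemeasurable hp]
    refine lintegral_congr fun x => ?_
    rw [← ofReal_norm, ENNReal.ofReal_rpow_of_nonneg (norm_nonneg _) hp.le, Real.norm_eq_abs]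
  -- the length `a / δ - a` of the range of `t` cancels the density `C ^ p / t ≤ C ^ p / a`
  have hinner : ∀ x, ∫⁻ t in Ioi 0, S t x ≤
      ENNReal.ofReal (C ^ p / δ) * gradNorm n u x ^ p := by
    intro x
    set a := |u x| with ha
    have hle : ∀ t ∈ Ioi (0 : ℝ), S t x ≤ (Icc a (a / δ)).indicator
        (fun _ => ENNReal.ofReal (C ^ p * a⁻¹) * gradNorm n u x ^ p) t := by
      intro t ht
      by_cases hx : δ * t ≤ |u x| ∧ |u x| ≤ t
      · have ha0 : 0 < a := (mul_pos hδ ht).trans_le hx.1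
        have hmem : t ∈ Icc a (a / δ) := ⟨hx.2, (le_div_iff₀' hδ).2 hx.1⟩
        rw [indicator_of_mem hmem]
        simp only [S, indicator_of_mem (show x ∈ {x | δ * t ≤ |u x| ∧ |u x| ≤ t} from hx)]
        have := hx.2
        gcongr
      · simp only [S, indicator_of_notMem (show x ∉ {x | δ * t ≤ |u x| ∧ |u x| ≤ t} from hx)]
        exact zero_le
    refine (setLIntegral_mono' measurableSet_Ioi hle).trans
      ((setLIntegral_le_lintegral _ _).trans ?_)
    rw [lintegral_indicator_const measurableSet_Icc, Real.volume_Icc, mul_right_comm,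
      ← ENNReal.ofReal_mul (by positivity)]
    gcongr
    rcases (abs_nonneg (u x)).eq_or_lt with h0 | h0
    · rw [ha, ← h0]; simp; positivity
    · rw [← ha] at h0
      have : C ^ p * a⁻¹ * (a / δ - a) = C ^ p / δ - C ^ p := by field_simp
      rw [this]
      linarith [Real.rpow_nonneg hC p]
  rw [hlayer, mul_left_comm]
  calc ENNReal.ofReal p * (mazyaConstant n M p *
        ∫⁻ t in Ioi 0, vol n M {x | t ≤ |u x|} * ENNReal.ofReal (t ^ (p - 1)))
    _ ≤ ENNReal.ofReal p * ∫⁻ t in Ioi 0, ∫⁻ x, S t x ∂(vol n M) := by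
      gcongr
      refine (lintegral_const_mul_le _ _).trans
        (setLIntegral_mono' measurableSet_Ioi fun t ht => ?_)
      have ht : 0 < t := ht
      rw [← mul_assoc]
      refine (mul_le_mul_left (mazyaConstant_mul_vol_le hu hp hφ hδ ht) _).trans ?_
      rw [← lintegral_mul_const' _ _ ENNReal.ofReal_ne_top]
      refine lintegral_mono fun x => ?_
      simp only [S, indicator_apply]
      split_ifs
      · rw [mul_right_comm, ENNReal.ofReal_rpow_of_nonneg (by positivity) hp.le,
          ← ENNReal.ofReal_mul (by positivity), Real.div_rpow hC ht.le, Real.rpow_sub_one ht.ne']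
        have : t ^ p ≠ 0 := (Real.rpow_pos_of_pos ht p).ne'
        refine le_of_eq ?_
        congr 2
        field_simp
      · simp
    _ = ENNReal.ofReal p * ∫⁻ x, (∫⁻ t in Ioi 0, S t x) ∂(vol n M) := by
      rw [lintegral_lintegral_swap hS.aemeasurable]
    _ ≤ ENNReal.ofReal p * ∫⁻ x, ENNReal.ofReal (C ^ p / δ) * gradNorm n u x ^ p ∂(vol n M) := by
      exact mul_le_mul_right (lintegral_mono hinner) _
    _ = _ := by
      rw [lintegral_const_mul' _ _ ENNReal.ofReal_ne_top, ← mul_assoc, ← ENNReal.ofReal_mul hp.le,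
        mul_div_assoc, energy]
end

/-! ### Limits as the exponent tends to infinity -/

theorem tendsto_ofReal_rpow_one_div {c : ℝ} (hc : 0 < c) :
    Tendsto (fun p : ℝ => ENNReal.ofReal c ^ (1 / p)) atTop (𝓝 1) := by
  have h1 : Tendsto (fun p : ℝ => 1 / p) atTop (𝓝 0) := by
    simpa using tendsto_inv_atTop_zero (𝕜 := ℝ)
  have h2 : Tendsto (fun p : ℝ => c ^ (1 / p)) atTop (𝓝 1) := by
    have := ((Real.continuous_const_rpow hc.ne').tendsto 0).comp h1
    rwa [Real.rpow_zero] at this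
  have h3 := ENNReal.tendsto_ofReal h2
  rw [ENNReal.ofReal_one] at h3
  exact h3.congr fun p => (ENNReal.ofReal_rpow_of_pos hc).symm

theorem tendsto_rpow_one_div {c : ℝ≥0∞} (h0 : c ≠ 0) (ht : c ≠ ⊤) :
    Tendsto (fun p : ℝ => c ^ (1 / p)) atTop (𝓝 1) := by
  rw [← ENNReal.ofReal_toReal ht]
  exact tendsto_ofReal_rpow_one_div (ENNReal.toReal_pos h0 ht)

section
variable {n : ℕ} {M : Type*} [MetricSpace M]
    [ChartedSpace (EuclideanSpace ℝ (Fin n)) M] [IsManifold (𝓡 n) ∞ M]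
    [RiemannianBundle (fun x : M => TangentSpace (𝓡 n) x)]
    [IsContMDiffRiemannianBundle (𝓡 n) ∞ (EuclideanSpace ℝ (Fin n))
      (fun x : M => TangentSpace (𝓡 n) x)]
    [IsRiemannianManifold (𝓡 n) M] [MeasurableSpace M] [BorelSpace M]

variable (n M) in
theorem sFinite_vol [ProperSpace M] : SFinite (vol n M) := by
  have := isFiniteMeasureOnCompacts_vol n M
  infer_instance

theorem mazyaConstant_le_mul_firstEigenvalue [SFinite (vol n M)] {p C δ : ℝ} (hp : 0 < p)
    (hC : 0 < C) {φ : ℝ → ℝ} (hφ : IsSmoothStep C δ φ) (hδ : 0 < δ) :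
    mazyaConstant n M p ≤ ENNReal.ofReal (p * C ^ p / δ) * firstEigenvalue n M p := by
  have hK : 0 < p * C ^ p / δ := by positivity
  have hK0 : ENNReal.ofReal (p * C ^ p / δ) ≠ 0 := by simpa using hK
  rw [mul_comm, ← ENNReal.div_le_iff hK0 ENNReal.ofReal_ne_top]
  refine le_iInf₂ fun u hu => ?_
  rw [ENNReal.div_le_iff hK0 ENNReal.ofReal_ne_top, mul_comm, ← mul_div_assoc,
    ENNReal.le_div_iff_mul_le (Or.inl (hu.1.lintegral_rpow_ne_zero hu.2 hp))
      (Or.inl (hu.1.lintegral_rpow_ne_top hp))]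
  exact mazyaConstant_mul_lintegral_le hu.1 hp hφ hδ

variable (n M) in
theorem exists_tendsto_scaledEigenvalue :
    ∃ L, Tendsto (scaledEigenvalue n M) atTop (𝓝 L) := by
  have hm : Monotone fun p : ℝ => scaledEigenvalue n M (max 1 p) := fun p q hpq =>
    scaledEigenvalue_mono (by positivity) (max_le_max le_rfl hpq)
  refine ⟨_, (tendsto_atTop_iSup hm).congr' ?_⟩
  filter_upwards [eventually_ge_atTop 1] with p hp
  rw [max_eq_right hp]

/-- The `p`-th root of the constant `p C^p / δ` in Maz'ya's inequality tends to `C`, and `C > 1`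
is arbitrary: the Maz'ya constants and the eigenvalues have the same limit. -/
theorem tendsto_scaledMazyaConstant [SFinite (vol n M)] {L : ℝ≥0∞}
    (hL : Tendsto (scaledEigenvalue n M) atTop (𝓝 L)) :
    Tendsto (scaledMazyaConstant n M) atTop (𝓝 L) := by
  have hle : ∀ᶠ p in atTop, scaledEigenvalue n M p ≤ scaledMazyaConstant n M p := by
    filter_upwards [eventually_gt_atTop 0] with p hp
    unfold scaledEigenvalue scaledMazyaConstant
    gcongr
    exact firstEigenvalue_le_mazyaConstant hp
  refine tendsto_order.2 ⟨fun a ha => ?_, fun b hb => ?_⟩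
  · filter_upwards [hle, hL.eventually_const_lt ha] with p h1 h2 using h2.trans_le h1
  -- it suffices to lose an arbitrary constant factor `C > 1`
  obtain ⟨C, hC1, hC⟩ : ∃ C : ℝ, 1 < C ∧ ENNReal.ofReal C * L < b := by
    have h1 : Tendsto (fun C : ℝ => ENNReal.ofReal C * L) (𝓝[>] 1) (𝓝 L) := by
      have h2 := ENNReal.Tendsto.mul_const (b := L) (ENNReal.tendsto_ofReal
        (tendsto_id (x := 𝓝 (1 : ℝ)))) (Or.inl (by simp))
      simpa using h2.mono_left nhdsWithin_le_nhds
    obtain ⟨C, h2, h3⟩ := ((h1.eventually_lt_const hb).and self_mem_nhdsWithin).exists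
    exact ⟨C, h3, h2⟩
  obtain ⟨δ, φ, hδ, hφ⟩ := exists_isSmoothStep hC1
  have hC0 : 0 < C := by linarith
  have hfac : Tendsto (fun p : ℝ => ENNReal.ofReal C * (ENNReal.ofReal (p ^ (1 / p)) *
      ENNReal.ofReal δ⁻¹ ^ (1 / p)) * scaledEigenvalue n M p) atTop
      (𝓝 (ENNReal.ofReal C * (ENNReal.ofReal 1 * 1) * L)) := by
    refine ENNReal.Tendsto.mul (ENNReal.Tendsto.const_mul (ENNReal.Tendsto.mul
      (ENNReal.tendsto_ofReal tendsto_rpow_div) (by simp)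
      (tendsto_ofReal_rpow_one_div (inv_pos.2 hδ)) (by simp)) (by simp))
      (by simp [hC0]) hL (by simp)
  rw [ENNReal.ofReal_one, mul_one, mul_one] at hfac
  filter_upwards [hfac.eventually_lt_const hC, eventually_gt_atTop 0] with p hlt hp
  refine lt_of_le_of_lt ?_ hlt
  unfold scaledMazyaConstant scaledEigenvalue
  refine (mul_le_mul_right (ENNReal.rpow_le_rpow
    (mazyaConstant_le_mul_firstEigenvalue hp hC0 hφ hδ) (by positivity)) _).trans_eq ?_
  have h1 : ENNReal.ofReal (p * C ^ p / δ) ^ (1 / p) = ENNReal.ofReal C *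
      (ENNReal.ofReal (p ^ (1 / p)) * ENNReal.ofReal δ⁻¹ ^ (1 / p)) := by
    rw [ENNReal.ofReal_rpow_of_pos (by positivity), ENNReal.ofReal_rpow_of_pos (by positivity),
      ← ENNReal.ofReal_mul (by positivity), ← ENNReal.ofReal_mul hC0.le, div_eq_mul_inv,
      Real.mul_rpow (by positivity) (by positivity), Real.mul_rpow hp.le (by positivity),
      ← Real.rpow_mul hC0.le, mul_one_div_cancel hp.ne', Real.rpow_one]
    congr 1; ring
  rw [ENNReal.mul_rpow_of_nonneg _ _ (by positivity), h1]
  ring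

/-- A compact smooth domain has nonempty interior: otherwise a local defining function would be
nonnegative near a boundary point, and its differential would vanish there. -/
theorem IsCompactSmoothDomain.vol_ne_zero {Ω : Set M}
    (hΩ : IsCompactSmoothDomain n Ω) : vol n M Ω ≠ 0 := by
  have := isOpenPosMeasure_vol n M
  suffices (interior Ω).Nonempty from
    fun h => (isOpen_interior.measure_pos (vol n M) this).ne' (measure_mono_null interior_subset h)
  by_contra hint
  rw [not_nonempty_iff_eq_empty] at hint
  obtain ⟨x, hx⟩ := hΩ.nonempty
  have hxf : x ∈ frontier Ω := by
    rw [frontier, hint, sdiff_empty]; exact subset_closure hx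
  obtain ⟨f, hf, hfx, hdf, hev⟩ := hΩ.smooth_boundary x hxf
  have hmin : ∀ᶠ y in 𝓝 x, 0 ≤ f y := by
    filter_upwards [hev.eventually_nhds] with y hy
    -- a point near `x` with `f < 0` would be interior to `Ω`
    by_contra! hneg
    have : y ∈ interior Ω := mem_interior_iff_mem_nhds.2 (by
      filter_upwards [hy, hf.continuous.continuousAt.eventually_lt_const hneg] with z hz hz'
      exact hz.2 hz'.le)
    rw [hint] at this
    exact this
  -- a local minimum of `f` would force `df = 0`
  apply hdf
  obtain ⟨e, hxe, -, he⟩ := exists_isNearIsometricChart (n := n) x one_lt_two univ_mem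
  have h1 : ContDiffOn ℝ ∞ (f ∘ e.symm) e.target :=
    contMDiffOn_iff_contDiffOn.1 (hf.comp_contMDiffOn he.contMDiffOn_symm)
  have h2 : fderiv ℝ (f ∘ e.symm) (e x) = 0 := by
    refine IsLocalMin.fderiv_eq_zero ?_
    have := (e.continuousAt_symm (e.map_source hxe)).tendsto
    rw [e.left_inv hxe] at this
    filter_upwards [this.eventually hmin] with z hz
    simpa [e.left_inv hxe, hfx] using hz
  have h3 : gradNorm n f x ≤ 2 * ‖fderiv ℝ (f ∘ e.symm) (e x)‖ₑ := by
    refine he.gradNorm_le hxe ((h1.contDiffAt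
      (e.open_target.mem_nhds (e.map_source hxe))).differentiableAt (by simp)) ?_
    filter_upwards [e.open_source.mem_nhds hxe] with z hz
    simp [e.left_inv hz]
  have h5 : ‖fderiv ℝ (f ∘ e.symm) (e x)‖ₑ = 0 := by
    rw [h2]; exact enorm_zero (E := EuclideanSpace ℝ (Fin n) →L[ℝ] ℝ)
  rw [h5, mul_zero, gradNorm_le_iff] at h3
  refine ContinuousLinearMap.ext fun w => ?_
  have h4 := h3 w
  rw [zero_mul, nonpos_iff_eq_zero, enorm_eq_zero] at h4
  exact h4

theorem le_infinityCapacity_of_tendsto {L : ℝ≥0∞}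
    (hL : Tendsto (scaledMazyaConstant n M) atTop (𝓝 L)) {Ω : Set M}
    (hΩ : IsCompactSmoothDomain n Ω) : L ≤ infinityCapacity n Ω := by
  have := isFiniteMeasureOnCompacts_vol n M
  have h1 : Tendsto (fun p => scaledMazyaConstant n M p * vol n M Ω ^ (1 / p)) atTop (𝓝 (L * 1)) :=
    ENNReal.Tendsto.mul hL (by simp)
      (tendsto_rpow_one_div hΩ.vol_ne_zero hΩ.isCompact.measure_ne_top) (by simp)
  rw [mul_one] at h1
  rw [← h1.limsup_eq, infinityCapacity]
  refine limsup_le_limsup ?_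
  filter_upwards [eventually_gt_atTop 0] with p hp
  rw [scaledMazyaConstant, mul_assoc, ← ENNReal.mul_rpow_of_nonneg _ _ (by positivity)]
  gcongr
  exact ENNReal.mul_le_of_le_div (iInf₂_le Ω ⟨hΩ.isCompact, hΩ.vol_ne_zero⟩)

/-! ### Capacity and volume growth -/

theorem sum_exp_neg_mul_le {ε : ℝ} (hε : 0 < ε) (N : ℕ) :
    ∑ j ∈ Finset.range N, Real.exp (-ε * j) ≤ (1 - Real.exp (-ε))⁻¹ := by
  have h1 : Real.exp (-ε) < 1 := Real.exp_lt_one_iff.2 (by linarith)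
  have h2 : ∀ j : ℕ, Real.exp (-ε * j) = Real.exp (-ε) ^ j := fun j => by
    rw [← Real.exp_nat_mul, mul_comm]
  simp_rw [h2]
  rw [← tsum_geometric_of_lt_one (Real.exp_nonneg _) h1]
  exact (summable_geometric_of_lt_one (Real.exp_nonneg _) h1).sum_le_tsum _
    fun _ _ => by positivity

theorem exists_le_sum_exp_neg_mul {a ε : ℝ} (ha : 0 < a) (hε : 0 < ε) :
    ∃ N, ((1 + ε) * a)⁻¹ ≤ ∑ j ∈ Finset.range N, Real.exp (-a * j) := by
  have h1 : Real.exp (-a) < 1 := Real.exp_lt_one_iff.2 (by linarith)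
  have h2 : ∀ j : ℕ, Real.exp (-a * j) = Real.exp (-a) ^ j := fun j => by
    rw [← Real.exp_nat_mul, mul_comm]
  have h3 := (hasSum_geometric_of_lt_one (Real.exp_nonneg _) h1).tendsto_sum_nat
  have h4 : ((1 + ε) * a)⁻¹ < (1 - Real.exp (-a))⁻¹ := by
    have := Real.add_one_le_exp (-a)
    exact inv_strictAnti₀ (by linarith) (by nlinarith)
  simp_rw [h2]
  exact ((h3.eventually_const_lt h4).exists).imp fun _ h => h.le

theorem gradNorm_const_mul_le {u : M → ℝ} (hu : IsTestFunction n u) (c : ℝ) (x : M) :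
    gradNorm n (fun y => c * u y) x ≤ ENNReal.ofReal |c| * gradNorm n u x := by
  have h := gradNorm_comp_le (n := n) (φ := fun s => c * s) (x := x) (by fun_prop)
    (hu.1.mdifferentiable (by simp) x)
  refine h.trans_eq ?_
  rw [deriv_const_mul_field, deriv_id'', mul_one, ← ofReal_norm, Real.norm_eq_abs]

/-- Energy of a combination of cutoffs whose gradients live on disjoint annuli of width `1`: at
each point at most one of the gradients is nonzero. -/
theorem energy_layers_le {o : M} {K N : ℕ} {p ε : ℝ} (hp : 0 < p) (hε : 0 < ε)
    {θ : ℕ → M → ℝ} (hθ : ∀ j, IsTestFunction n (θ j))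
    (hle : ∀ j x, gradNorm n (θ j) x ≤ ENNReal.ofReal (1 + ε))
    (hz : ∀ j : ℕ, ∀ x, dist x o ≤ (K + j : ℕ) ∨ (K + j : ℕ) + 1 ≤ dist x o →
      gradNorm n (θ j) x = 0) {c : ℕ → ℝ} (hc : ∀ j, 0 ≤ c j) :
    energy n p (fun x => ∑ j ∈ Finset.range N, c j * θ j x) ≤
      ∑ j ∈ Finset.range N, ENNReal.ofReal ((c j * (1 + ε)) ^ p) *
        vol n M (Metric.ball o ((K + j : ℕ) + 1)) := by
  have hpt : ∀ x, gradNorm n (fun x => ∑ j ∈ Finset.range N, c j * θ j x) x ^ p ≤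
      ∑ j ∈ Finset.range N, (Metric.ball o ((K + j : ℕ) + 1)).indicator
        (fun _ => ENNReal.ofReal ((c j * (1 + ε)) ^ p)) x := by
    intro x
    have h1 : gradNorm n (fun x => ∑ j ∈ Finset.range N, c j * θ j x) x ≤
        ∑ j ∈ Finset.range N, ENNReal.ofReal (c j) * gradNorm n (θ j) x := by
      refine (gradNorm_sum_le (f := fun j y => c j * θ j y) fun j _ =>
        ((contMDiff_const.mul (hθ j).1).mdifferentiable (by simp) x)).trans
        (Finset.sum_le_sum fun j _ => ?_)
      simpa [abs_of_nonneg (hc j)] using gradNorm_const_mul_le (hθ j) (c j) x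
    by_cases hex : ∃ j ∈ Finset.range N, (K + j : ℕ) < dist x o ∧ dist x o < (K + j : ℕ) + 1
    · obtain ⟨j, hj, hj1, hj2⟩ := hex
      rw [Finset.sum_eq_single_of_mem j hj] at h1
      · refine (ENNReal.rpow_le_rpow (h1.trans (mul_le_mul_right (hle j x) _)) hp.le).trans ?_
        refine le_trans ?_ (Finset.single_le_sum (fun _ _ => zero_le) hj)
        rw [indicator_of_mem (Metric.mem_ball.2 hj2), ← ENNReal.ofReal_mul (hc j),
          ENNReal.ofReal_rpow_of_nonneg (mul_nonneg (hc j) (by linarith)) hp.le]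
      · intro i hi hij
        rw [hz i x, mul_zero]
        rcases lt_or_gt_of_ne hij with h | h
        · right
          have : ((K + i : ℕ) : ℝ) + 1 ≤ (K + j : ℕ) := by exact_mod_cast (by omega)
          linarith
        · left
          have : ((K + j : ℕ) : ℝ) + 1 ≤ (K + i : ℕ) := by exact_mod_cast (by omega)
          linarith
    · rw [Finset.sum_eq_zero, nonpos_iff_eq_zero] at h1
      · rw [h1, ENNReal.zero_rpow_of_pos hp]; exact zero_le
      · intro j hj
        rw [hz j x, mul_zero]
        by_contra! h
        exact hex ⟨j, hj, h⟩
  refine (lintegral_mono hpt).trans_eq ?_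
  rw [lintegral_finsetSum _ fun j _ => measurable_const.indicator Metric.isOpen_ball.measurableSet]
  refine Finset.sum_congr rfl fun j _ => ?_
  rw [lintegral_indicator_const Metric.isOpen_ball.measurableSet]

/-- If the balls around `o` grow at most like `A exp (V k)`, the capacity is bounded by means of
cutoffs on successive annuli, combined with the weights `exp (-a j)` normalised to total weight
`1`, where `a = (V + ε) / p`. The normalisation costs a factor of about `a` in the gradient, and
the `p`-th powers `exp (-(V + ε) j)` of the weights offset the volume growth. -/
theorem capacity_le_of_exp_growth [ProperSpace M] {o : M} {V A ε : ℝ} (hV : 0 < V) (hA : 0 ≤ A)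
    (hε : 0 < ε) (hvol : ∀ k : ℕ, vol n M (Metric.ball o (k + 1)) ≤
      ENNReal.ofReal (A * Real.exp (V * k))) {Ω : Set M} {K : ℕ}
    (hΩ : Ω ⊆ Metric.closedBall o K) {p : ℝ} (hp : 0 < p) :
    capacity n p Ω ≤ ENNReal.ofReal (((1 + ε) * ((1 + ε) * ((V + ε) / p))) ^ p *
      (A * Real.exp (V * K) * (1 - Real.exp (-ε))⁻¹)) := by
  obtain ⟨a, ha⟩ : ∃ a, a = (V + ε) / p := ⟨_, rfl⟩
  have ha0 : 0 < a := ha ▸ by positivity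
  obtain ⟨N, hN⟩ := exists_le_sum_exp_neg_mul ha0 hε
  choose θ hθ hθ1 hθle hθz using fun j : ℕ =>
    exists_cutoff (n := n) o ((K + j : ℕ) : ℝ) hε
  set S := ∑ j ∈ Finset.range N, Real.exp (-a * j)
  have hS0 : 0 < S := lt_of_lt_of_le (by positivity) hN
  let c : ℕ → ℝ := fun j => Real.exp (-a * j) / S
  have hc : ∀ j, 0 ≤ c j := fun j => by positivity
  have hcp : ∀ j, (c j * (1 + ε)) ^ p ≤
      ((1 + ε) * ((1 + ε) * a)) ^ p * Real.exp (-(V + ε) * j) := by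
    intro j
    have h1 : c j * (1 + ε) ≤ (1 + ε) * ((1 + ε) * a) * Real.exp (-a * j) := by
      have h2 : S⁻¹ ≤ (1 + ε) * a := inv_le_of_inv_le₀ (by positivity) hN
      calc c j * (1 + ε) = (1 + ε) * S⁻¹ * Real.exp (-a * j) := by simp only [c]; field_simp
        _ ≤ _ := by gcongr
    refine (Real.rpow_le_rpow (by positivity) h1 hp.le).trans_eq ?_
    rw [Real.mul_rpow (by positivity) (by positivity), ← Real.exp_mul]
    congr 2
    rw [ha]; field_simp
  have htest : IsTestFunction n fun x => ∑ j ∈ Finset.range N, c j * θ j x := by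
    refine ⟨contMDiff_finsetSum fun j _ => contMDiff_const.mul (hθ j).1, ?_⟩
    refine HasCompactSupport.intro (K := ⋃ j ∈ Finset.range N, tsupport (θ j))
      ((Finset.range N).isCompact_biUnion fun j _ => (hθ j).2.isCompact) fun x hx =>
      Finset.sum_eq_zero fun j hj => ?_
    rw [image_eq_zero_of_notMem_tsupport fun h => hx (mem_iUnion₂.2 ⟨j, hj, h⟩), mul_zero]
  have hone : ∀ x ∈ Ω, ∑ j ∈ Finset.range N, c j * θ j x = 1 := by
    intro x hx
    have h1 : ∀ j ∈ Finset.range N, c j * θ j x = Real.exp (-a * j) / S := fun j _ => by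
      rw [hθ1 j x, mul_one]
      have := Metric.mem_closedBall.1 (hΩ hx)
      push_cast
      linarith [Nat.cast_nonneg (α := ℝ) j]
    rw [Finset.sum_congr rfl h1, ← Finset.sum_div, div_self hS0.ne']
  refine (iInf₂_le _ ⟨htest, hone⟩).trans ((energy_layers_le hp hε hθ hθle hθz hc).trans ?_)
  rw [← ha]
  calc _ ≤ ∑ j ∈ Finset.range N, ENNReal.ofReal (((1 + ε) * ((1 + ε) * a)) ^ p *
          (A * Real.exp (V * K)) * Real.exp (-ε * j)) := by
        refine Finset.sum_le_sum fun j _ => ?_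
        refine (mul_le_mul' (ENNReal.ofReal_le_ofReal (hcp j)) (hvol (K + j))).trans_eq ?_
        rw [← ENNReal.ofReal_mul (by positivity)]
        congr 1
        have : Real.exp (-(V + ε) * j) * Real.exp (V * (K + j : ℕ)) =
            Real.exp (V * K) * Real.exp (-ε * j) := by
          rw [← Real.exp_add, ← Real.exp_add]; congr 1; push_cast; ring
        linear_combination (((1 + ε) * ((1 + ε) * a)) ^ p * A) * this
    _ = ENNReal.ofReal (((1 + ε) * ((1 + ε) * a)) ^ p * (A * Real.exp (V * K)) *
          ∑ j ∈ Finset.range N, Real.exp (-ε * j)) := by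
        rw [← ENNReal.ofReal_sum_of_nonneg fun j _ => by positivity, Finset.mul_sum]
    _ ≤ _ := by
        rw [mul_assoc (_ ^ p)]
        refine ENNReal.ofReal_le_ofReal ?_
        have := sum_exp_neg_mul_le hε N
        gcongr

/-- In `p · Cap_p(Ω)^(1/p)` the bound of `capacity_le_of_exp_growth` becomes, as `p → ∞`, `(1 +
ε)² (V + ε)`. -/
theorem infinityCapacity_le_of_exp_growth [ProperSpace M] {o : M} {V A : ℝ} (hV : 0 < V)
    (hA : 0 < A) (hvol : ∀ k : ℕ, vol n M (Metric.ball o (k + 1)) ≤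
      ENNReal.ofReal (A * Real.exp (V * k))) {Ω : Set M} (hΩ : IsCompact Ω) :
    infinityCapacity n Ω ≤ ENNReal.ofReal V := by
  obtain ⟨r, hr⟩ := hΩ.isBounded.subset_closedBall o
  obtain ⟨K, hK⟩ := exists_nat_ge r
  have hΩK : Ω ⊆ Metric.closedBall o K := hr.trans (Metric.closedBall_subset_closedBall hK)
  have key : ∀ ε > 0, infinityCapacity n Ω ≤
      ENNReal.ofReal ((1 + ε) * ((1 + ε) * (V + ε))) := by
    intro ε hε
    have hexp : Real.exp (-ε) < 1 := Real.exp_lt_one_iff.2 (by linarith)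
    have hD : 0 < A * Real.exp (V * K) * (1 - Real.exp (-ε))⁻¹ :=
      mul_pos (by positivity) (inv_pos.2 (by linarith))
    set D := A * Real.exp (V * K) * (1 - Real.exp (-ε))⁻¹
    set B := (1 + ε) * ((1 + ε) * (V + ε)) with hB
    have hlim : Tendsto (fun p : ℝ => ENNReal.ofReal B * ENNReal.ofReal D ^ (1 / p)) atTop
        (𝓝 (ENNReal.ofReal B * 1)) :=
      ENNReal.Tendsto.const_mul (tendsto_ofReal_rpow_one_div hD) (by simp)
    rw [mul_one] at hlim
    rw [← hlim.limsup_eq, infinityCapacity]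
    refine limsup_le_limsup ?_
    filter_upwards [eventually_gt_atTop 0] with p hp
    have h1 := capacity_le_of_exp_growth hV hA.le hε hvol hΩK hp
    have h2 : 0 ≤ (1 + ε) * ((1 + ε) * ((V + ε) / p)) := by positivity
    calc ENNReal.ofReal p * capacity n p Ω ^ (1 / p)
      _ ≤ ENNReal.ofReal p *
          ENNReal.ofReal (((1 + ε) * ((1 + ε) * ((V + ε) / p))) ^ p * D) ^ (1 / p) := by gcongr
      _ = _ := by
        rw [ENNReal.ofReal_mul (by positivity), ENNReal.mul_rpow_of_nonneg _ _ (by positivity),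
          ← ENNReal.ofReal_rpow_of_nonneg h2 hp.le, ← ENNReal.rpow_mul, mul_one_div_cancel hp.ne',
          ENNReal.rpow_one, ← mul_assoc, ← ENNReal.ofReal_mul hp.le]
        congr 2
        rw [hB]; field_simp
  have hcont : Continuous fun ε : ℝ => ENNReal.ofReal ((1 + ε) * ((1 + ε) * (V + ε))) :=
    ENNReal.continuous_ofReal.comp (by fun_prop)
  have h0 := (hcont.tendsto 0).mono_left (nhdsWithin_le_nhds (s := Ioi 0))
  simp only [add_zero, one_mul] at h0
  exact ge_of_tendsto h0 (by filter_upwards [self_mem_nhdsWithin] with ε hε using key ε hε)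

/-- The volume entropy is nonnegative because `|B(o,R)| ≥ |B(o,1)| > 0` for `R ≥ 1`. -/
theorem volumeEntropy_nonneg [ProperSpace M] (o : M) : 0 ≤ volumeEntropy n o := by
  have := isFiniteMeasureOnCompacts_vol n M
  have := isOpenPosMeasure_vol n M
  set c := vol n M (Metric.ball o 1) with hc
  have h0 : c ≠ 0 := (Metric.measure_ball_pos _ o one_pos).ne'
  have ht : c ≠ ⊤ := measure_ball_lt_top.ne
  have h1 : Tendsto (fun R : ℝ => ((c.toReal.log / R : ℝ) : EReal)) atTop (𝓝 ((0 : ℝ) : EReal)) :=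
    (continuous_coe_real_ereal.tendsto 0).comp (tendsto_const_nhds.div_atTop tendsto_id)
  rw [← EReal.coe_zero, ← h1.limsup_eq, volumeEntropy]
  refine limsup_le_limsup ?_
  filter_upwards [eventually_ge_atTop 1] with R hR
  rw [EReal.coe_div, ← ENNReal.log_pos_real h0 ht]
  refine EReal.div_le_div_right_of_nonneg (by exact_mod_cast (by linarith)) ?_
  exact ENNReal.log_monotone (measure_mono (Metric.ball_subset_ball hR))

theorem exists_vol_ball_le_of_volumeEntropy_lt [ProperSpace M] {o : M} {V : ℝ} (hV : 0 < V)
    (h : volumeEntropy n o < V) : ∃ A > 0, ∀ k : ℕ, vol n M (Metric.ball o (k + 1)) ≤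
      ENNReal.ofReal (A * Real.exp (V * k)) := by
  have := isFiniteMeasureOnCompacts_vol n M
  have h1 := eventually_lt_of_limsup_lt h
  obtain ⟨R₀, hR₀⟩ := (h1.and (eventually_gt_atTop 0)).exists_forall_of_atTop
  have ht : vol n M (Metric.ball o R₀) ≠ ⊤ := measure_ball_lt_top.ne
  refine ⟨max (Real.exp V) (vol n M (Metric.ball o R₀)).toReal,
    lt_max_of_lt_left (Real.exp_pos V), fun k => ?_⟩
  rcases le_total R₀ (k + 1) with hk | hk
  · obtain ⟨h2, h3⟩ := hR₀ _ hk
    rw [EReal.div_lt_iff (by exact_mod_cast h3) (EReal.coe_ne_top _), ← EReal.coe_mul] at h2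
    have h4 : vol n M (Metric.ball o (k + 1)) ≤ ENNReal.ofReal (Real.exp (V * (k + 1))) := by
      rw [← ENNReal.log_le_log_iff, ENNReal.log_ofReal_of_pos (Real.exp_pos _), Real.log_exp]
      exact h2.le
    refine h4.trans (ENNReal.ofReal_le_ofReal ?_)
    rw [mul_add, mul_one, Real.exp_add, mul_comm]
    gcongr
    exact le_max_left _ _
  · refine (measure_mono (Metric.ball_subset_ball hk)).trans ?_
    refine (ENNReal.ofReal_toReal ht).symm.le.trans (ENNReal.ofReal_le_ofReal
      ((le_max_right _ _).trans (le_mul_of_one_le_right ?_ ?_)))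
    · positivity
    · exact Real.one_le_exp (by positivity)

theorem infinityCapacity_le_volumeEntropy [ProperSpace M] (o : M) {Ω : Set M} (hΩ : IsCompact Ω) :
    (infinityCapacity n Ω : EReal) ≤ volumeEntropy n o := by
  refine le_of_forall_gt_imp_ge_of_dense fun c hc => ?_
  obtain ⟨V, hV1, hV2⟩ := EReal.lt_iff_exists_real_btwn.1 hc
  have hV : 0 < V := by exact_mod_cast (volumeEntropy_nonneg (n := n) o).trans_lt hV1
  obtain ⟨A, hA, hvol⟩ := exists_vol_ball_le_of_volumeEntropy_lt hV hV1
  have h1 := infinityCapacity_le_of_exp_growth hV hA hvol hΩ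
  refine le_trans ?_ hV2.le
  have h2 := EReal.coe_ennreal_le_coe_ennreal_iff.2 h1
  rwa [EReal.coe_ennreal_ofReal, max_eq_left hV.le] at h2
end

end RiemannianAsymptotics


theorem theorem1p6 (n : ℕ) (M : Type*) [MetricSpace M]
    [ChartedSpace (EuclideanSpace ℝ (Fin n)) M] [IsManifold (𝓡 n) ∞ M]
    [RiemannianBundle (fun x : M => TangentSpace (𝓡 n) x)]
    [IsContMDiffRiemannianBundle (𝓡 n) ∞ (EuclideanSpace ℝ (Fin n))
      (fun x : M => TangentSpace (𝓡 n) x)]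
    [IsRiemannianManifold (𝓡 n) M]
    [ConnectedSpace M] [CompleteSpace M] [NoncompactSpace M]
    [MeasurableSpace M] [BorelSpace M] :
    Tendsto (RiemannianAsymptotics.scaledEigenvalue n M) atTop
      (𝓝 (RiemannianAsymptotics.infinityEigenvalue n M)) ∧
    Tendsto (RiemannianAsymptotics.scaledMazyaConstant n M) atTop
      (𝓝 (RiemannianAsymptotics.mazyaLimit n M)) ∧
    RiemannianAsymptotics.infinityEigenvalue n M = RiemannianAsymptotics.mazyaLimit n M ∧
    0 ≤ RiemannianAsymptotics.mazyaLimit n M ∧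
    ∀ Ω : Set M, RiemannianAsymptotics.IsCompactSmoothDomain n Ω →
      (∀ o : M, RiemannianAsymptotics.volumeEntropy n o ≥
        (RiemannianAsymptotics.infinityCapacity n Ω : EReal)) ∧
      RiemannianAsymptotics.infinityCapacity n Ω ≥
        RiemannianAsymptotics.infinityEigenvalue n M := by
  have := RiemannianAsymptotics.properSpace_of_complete n M
  have := RiemannianAsymptotics.sFinite_vol n M
  obtain ⟨L, hL⟩ := RiemannianAsymptotics.exists_tendsto_scaledEigenvalue n M
  have hm := RiemannianAsymptotics.tendsto_scaledMazyaConstant hL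
  have h1 : RiemannianAsymptotics.infinityEigenvalue n M = L := hL.limUnder_eq
  have h2 : RiemannianAsymptotics.mazyaLimit n M = L := hm.limUnder_eq
  rw [h1, h2]
  exact ⟨hL, hm, rfl, zero_le, fun Ω hΩ =>
    ⟨fun o => RiemannianAsymptotics.infinityCapacity_le_volumeEntropy o hΩ.isCompact,
      RiemannianAsymptotics.le_infinityCapacity_of_tendsto hm hΩ⟩⟩
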